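/- **Gardiner formula for Hitchin deformations at the Fuchsian locus.** *Setting.* Let $X=\Gamma\backslash\mathbb H$ be a closed hyperbolic Riemann surface (metric $|dz|^2/y^2$), where $\Gamma\subset \mathrm{SL}(2,\mathbb R)$ is discrete and acts freely and cocompactly on $\mathbb H$; let $S$ be the spin bundle ($S^2=K$) given by $\Gamma$. Let $2\le k\le n$ and $E=\mathrm{Sym}^{n-1}(S\oplus S^{-1})=\bigoplus_{p=1}^n S^{2p-n-1}$. Let $X_n,Y_n$ be the $n\times n$ matrices with $-X_nw_p=c_pw_{p+1}$, $Y_nw_{p+1}=c_pw_p$, $c_p=\sqrt{p(n-p)/2}$ (for $1\le p<n$), $X_nw_n=0$, $Y_nw_1=0$, and put $E^0_j=(-\sqrt2X_n)^j$. Matrices are read in the frame $w_p=dz^{(2p-n-1)/2}$ of $E$. Fix $r>0$; it normalizes the Hermitian metric induced by the hyperbolic metric on $K^{-1}$: $|\partial_z|^2=(ry)^{-2}$, i.e. hyperbolic unit tangent vectors have Hermitian norm $1/r$. Let $\nabla$ be the Chern connection of the induced metric on $E$, $\Phi=\frac r{\sqrt2}Y_n\,dz$, $\rho(M)=-M^*$,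 and let $D=\nabla+\Phi-\rho(\Phi)$ be the flat connection at the Fuchsian point. Let $\sigma$ be minus the transpose about the antidiagonal (so $\sigma(E^0_j)=-E^0_j$, $\sigma(Y_n)=-Y_n$) and $\lambda=\sigma\circ\rho$. For $q_k=q_k(z)\,dz^k\in H^0(X,K^k)$ the standard Hitchin deformation is the $\mathrm{End}(E)$-valued $1$-form $$\psi^0(q_k)=\phi^0(q_k)+\lambda(\phi^0(q_k)),\qquad \phi^0(q_k)=q_k\otimes E^0_{k-1}=q_k(z)\,dz\,E^0_{k-1}.$$ Let $\gamma$ be a closed geodesic of length $\ell_\gamma$ (simple or not), with unit speed parametrization, and let $\lambda^{(p)}_\gamma$ be the absolute value of the $p$-th largest (in absolute value) eigenvalue of the holonomy, i.e. of the parallel transport along $\gamma$; $\lambda_\gamma=\lambda_\gamma^{(1)}$. We say that $\mathrm d\log\lambda^{(p)}_\gamma(\psi)=d$ if $\frac{d}{dt}\big|_{t=0}\log\lambda_\gamma^{(p)}$ exists and equals $d$ both * along every $C^1$ family of connections $D_t$ on $E$ with $D_0=D$ and $\dot D_0=\psi+d_DZ$ for some section $Z$ of $\mathrm{End}(E)$,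 and * along every curve $\delta_t:\Gamma\to\mathrm{SL}(n,\mathbb R)$ of representations (in particular every curve in the Hitchin component), differentiable at $t=0$, with $\delta_0$ the monodromy of $D$ and with tangent class $[\psi]\in H^1_D$ at $t=0$. *Theorem.* For all such $\Gamma,n,k,r,\gamma$ and all $q_k\in H^0(X,K^k)$, $$\mathrm d\log\lambda_\gamma(\psi^0(q_k))=r^{k-1}\,\frac{(-1)^k(n-1)!}{2^{k-2}(n-k)!}\int_0^{\ell_\gamma}\mathrm{Re}\,\big(q_k(\gamma',\dots,\gamma')\big)\,ds .$$ More generally, for $1\le p\le n$, $$\mathrm d\log\lambda^{(p)}_\gamma(\psi^0(q_k))=r^{k-1}\,c^{(p)}_{n,k}\int_0^{\ell_\gamma}\mathrm{Re}\,\big(q_k(\gamma',\dots,\gamma')\big)\,ds ,$$ $$c^{(p)}_{n,k}=\frac{(p-1)!\,(n-p)!}{2^{k-2}(n-k)!}\sum_{j=\max(1,k+p-n)}^{\min(k,p)}\binom{n-k}{p-j}\binom{k-1}{j-1}^2(-1)^{j+k+1}.$$ In particular, for $k=n$, $$\mathrm d\log\lambda^{(p)}_\gamma(\psi^0(q_n))=r^{n-1}\,(-1)^{p+n+1}\frac{(n-1)!}{2^{n-2}}\binom{n-1}{p-1}\int_0^{\ell_\gamma}\mathrm{Re}\,\big(q_n(\gamma',\dots,\gamma')\big)\,ds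 .$$ For $r=1$ (unit tangent vectors have Hermitian norm one) the powers of $r$ disappear; for $r=\sqrt2$ the Higgs field is $\Phi=Y_n\,dz$. -/

import Mathlib

open scoped UpperHalfPlane MatrixGroups Manifold

noncomputable section

namespace HitchinVariation

/-! ### The closed Riemann surface and its holomorphic differentials -/

/-- `Γ` is a discrete subgroup of `SL(2, ℝ)` acting freely and cocompactly on the upper half plane,
i.e. `X = Γ \ ℍ` is a closed hyperbolic Riemann surface together with a lift of its uniformizing
group to `SL(2, ℝ)` (equivalently, with a spin structure). -/
structure IsSurfaceGroup (Γ : Subgroup SL(2, ℝ)) : Prop where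
  discrete : DiscreteTopology Γ
  free : ∀ g ∈ Γ, g ≠ 1 → ∀ z : ℍ, g • z ≠ z
  cocompact : ∃ K : Set ℍ, IsCompact K ∧ ∀ z : ℍ, ∃ g ∈ Γ, g • z ∈ K

/-- The factor `c z + d` of `g = (a b; c d)`. -/
def autFactor (g : SL(2, ℝ)) (z : ℍ) : ℂ := (g 1 0 : ℂ) * (z : ℂ) + (g 1 1 : ℂ)

/-- The complex derivative `(c z + d)⁻²` of the Möbius transformation `z ↦ g • z`. -/
def mobiusDeriv (g : SL(2, ℝ)) (z : ℍ) : ℂ := (autFactor g z ^ 2)⁻¹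

/-- Holomorphic `k`-differentials on `Γ \ ℍ`, written as `q(z) dz ^ k` with `q` holomorphic
on `ℍ` and `g^* (q dz ^ k) = q dz ^ k` for every `g ∈ Γ`. -/
structure HolDifferential (Γ : Subgroup SL(2, ℝ)) (k : ℕ) where
  toFun : ℍ → ℂ
  holomorphic : MDiff toFun
  invariant : ∀ g ∈ Γ, ∀ z : ℍ, toFun (g • z) * mobiusDeriv g z ^ k = toFun z

/-- `c : ℝ → ℍ` is a unit speed geodesic line (`ℍ` has its hyperbolic distance, of curvature `-1`)
translated by `ℓ > 0` by the deck transformation `g`: it is the lift of the closed geodesic of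
length `ℓ` of `Γ \ ℍ` in the free homotopy class of `g`. -/
structure IsClosedGeodesic (g : SL(2, ℝ)) (c : ℝ → ℍ) (ℓ : ℝ) : Prop where
  pos : 0 < ℓ
  geodesic : Isometry c
  closed : ∀ s, c (s + ℓ) = g • c s

/-- The velocity of a curve in `ℍ`, as a complex number. -/
def velocity (c : ℝ → ℍ) (s : ℝ) : ℂ := deriv (fun r => (c r : ℂ)) s

/-- The period `∫_0^ℓ Re q(c', …, c') ds`. -/
def rePeriod {Γ : Subgroup SL(2, ℝ)} {k : ℕ} (q : HolDifferential Γ k) (c : ℝ → ℍ) (ℓ : ℝ) : ℝ :=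
  ∫ s in (0 : ℝ)..ℓ, (q.toFun (c s) * velocity c s ^ k).re

/-! ### The principal `sl(2)` -/

/-- The weight `2 i + 1 - n` (that is `2 p - n - 1` with `p = i + 1`) of the `i`-th basis vector. -/
def weight (n : ℕ) (i : Fin n) : ℤ := 2 * (i.val : ℤ) + 1 - (n : ℤ)

/-- `X`, with `(-X) w_p = c_p w_{p+1}`, `c_p = (p (n - p) / 2) ^ (1/2)`, `p = j + 1`. -/
def matX (n : ℕ) : Matrix (Fin n) (Fin n) ℂ := fun i j =>
  if i.val = j.val + 1 then
    -((Real.sqrt (((j.val : ℝ) + 1) * ((n : ℝ) - ((j.val : ℝ) + 1)) / 2) : ℝ) : ℂ) else 0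

/-- `Y`, with `Y w_{p+1} = c_p w_p`, `p = i + 1`. -/
def matY (n : ℕ) : Matrix (Fin n) (Fin n) ℂ := fun i j =>
  if j.val = i.val + 1 then
    ((Real.sqrt (((i.val : ℝ) + 1) * ((n : ℝ) - ((i.val : ℝ) + 1)) / 2) : ℝ) : ℂ) else 0

/-- The standard highest weight vectors `E⁰_k = (-√2 X) ^ k`. -/
def matE (n k : ℕ) : Matrix (Fin n) (Fin n) ℂ := (-(((Real.sqrt 2 : ℝ) : ℂ) • matX n)) ^ k

/-- The `ℂ`-linear involution `σ` of the Lie algebra of matrices with `σ(E⁰_k) = -E⁰_k`,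
`σ(Y) = -Y`: minus the transpose with respect to the antidiagonal. -/
def sigmaInv {n : ℕ} (M : Matrix (Fin n) (Fin n) ℂ) : Matrix (Fin n) (Fin n) ℂ := fun i j =>
  -M j.rev i.rev

/-! ### The bundle `E = Sym^{n-1}(S ⊕ S⁻¹) = ⊕_p S^{2p-n-1}` on `Γ \ ℍ`

On `ℍ` the bundle is trivialized by the frame `(dz ^ {(2p-n-1)/2})_p`. Sections over `Γ \ ℍ` are the
`f : ℍ → ℂⁿ` with `f (g • z) = J(g, z) f(z)`. -/

/-- The automorphy factor `J(g, z) = diag ((c z + d) ^ {2p-n-1})` of `E`. -/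
def automorphy (n : ℕ) (g : SL(2, ℝ)) (z : ℍ) : Matrix (Fin n) (Fin n) ℂ :=
  Matrix.diagonal fun i => autFactor g z ^ weight n i

/-- Matrix valued real `1`-forms on `ℍ`. -/
abbrev MatForm (n : ℕ) := ℍ → ℂ →ₗ[ℝ] Matrix (Fin n) (Fin n) ℂ

/-- The form descends to an `End E`-valued `1`-form on `Γ \ ℍ`. -/
def IsEndForm {n : ℕ} (Γ : Subgroup SL(2, ℝ)) (B : MatForm n) : Prop :=
  ∀ g ∈ Γ, ∀ (z : ℍ) (v : ℂ),
    B (g • z) (mobiusDeriv g z * v) = automorphy n g z * B z v * (automorphy n g z)⁻¹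

/-- The function descends to a section of `End E` on `Γ \ ℍ`. -/
def IsEndSection {n : ℕ} (Γ : Subgroup SL(2, ℝ)) (Z : ℍ → Matrix (Fin n) (Fin n) ℂ) : Prop :=
  ∀ g ∈ Γ, ∀ z : ℍ, Z (g • z) = automorphy n g z * Z z * (automorphy n g z)⁻¹

/-- `F` is (real) differentiable on `ℍ`, with exterior derivative `d F = B`. -/
def HasExtDeriv {n : ℕ} (F : ℍ → Matrix (Fin n) (Fin n) ℂ) (B : MatForm n) : Prop :=
  ∀ (z : ℍ) (i j : Fin n),
    HasFDerivAt (fun w : ℂ => F (UpperHalfPlane.ofComplex w) i j)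
      (Matrix.entryLinearMap ℝ ℂ i j ∘ₗ B z).toContinuousLinearMap (z : ℂ)

/-- The `(1,0)`-form `f(z) dz ⊗ M`. -/
def dzForm {n : ℕ} (f : ℍ → ℂ) (M : Matrix (Fin n) (Fin n) ℂ) : MatForm n := fun z =>
  { toFun := fun v => (f z * v) • M
    map_add' := fun v w => by rw [mul_add, add_smul]
    map_smul' := fun a v => by
      rw [RingHom.id_apply, mul_smul_comm, smul_assoc] }

/-! ### The Fuchsian point

The Hermitian metric on `K⁻¹` induced by the hyperbolic metric `|dz|² / y²` is fixed up to a
constant, which is the parameter `r > 0`: the metric is `|∂_z|² = 1 / (r y)²`, so that unit tangent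
vectors have norm `1 / r`, and correspondingly the Higgs field is `Φ = (r / √2) Y dz`. -/

/-- Gram matrix of the Hermitian metric on `E`: `|dz ^ {m/2}|² = (r y) ^ m`. -/
def hermMetric (n : ℕ) (r : ℝ) (w : ℂ) : Matrix (Fin n) (Fin n) ℂ :=
  Matrix.diagonal fun i => (((r * w.im) ^ weight n i : ℝ) : ℂ)

/-- The Cartan involution `ρ(M) = -M^*` at `z`, the adjoint being taken for the Hermitian metric. -/
def cartanInv {n : ℕ} (r : ℝ) (z : ℍ) (M : Matrix (Fin n) (Fin n) ℂ) :
    Matrix (Fin n) (Fin n) ℂ :=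
  -((hermMetric n r z)⁻¹ * M.conjTranspose * hermMetric n r z)

/-- The real split involution `λ = σ ∘ ρ`. -/
def splitInv {n : ℕ} (r : ℝ) (z : ℍ) (M : Matrix (Fin n) (Fin n) ℂ) :
    Matrix (Fin n) (Fin n) ℂ :=
  sigmaInv (cartanInv r z M)

/-- `∂f/∂z = (∂f/∂x - i ∂f/∂y) / 2`. -/
def wirtinger (f : ℂ → ℂ) (z : ℂ) : ℂ :=
  (fderiv ℝ f z 1 - Complex.I * fderiv ℝ f z Complex.I) / 2

/-- The form `H⁻¹ ∂H` of the Chern connection `∇ = d + H⁻¹ ∂H` of the Hermitian metric, evaluated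
at the tangent vector `v`. -/
def chernForm (n : ℕ) (r : ℝ) (z : ℍ) (v : ℂ) : Matrix (Fin n) (Fin n) ℂ :=
  v • ((hermMetric n r z)⁻¹ * Matrix.of fun i j => wirtinger (fun w => hermMetric n r w i j) z)

/-- The Higgs field `Φ = (r / √2) Y dz` of the Fuchsian point. -/
def higgsField (n : ℕ) (r : ℝ) : MatForm n :=
  dzForm (fun _ => ((r / Real.sqrt 2 : ℝ) : ℂ)) (matY n)

/-- The connection form of the flat connection `D = ∇ + Φ - ρ(Φ)` of the Fuchsian point. -/
def fuchsianForm (n : ℕ) (r : ℝ) (z : ℍ) (v : ℂ) : Matrix (Fin n) (Fin n) ℂ :=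
  chernForm n r z v + higgsField n r z v - cartanInv r z (higgsField n r z v)

/-- The standard oper deformation `φ⁰(q) = q ⊗ E⁰_{k-1}`. -/
def operDeformation (n : ℕ) {Γ : Subgroup SL(2, ℝ)} {k : ℕ} (q : HolDifferential Γ k) :
    MatForm n :=
  dzForm q.toFun (matE n (k - 1))

/-- The standard Hitchin deformation `ψ⁰(q) = φ⁰(q) + λ(φ⁰(q))`. -/
def hitchinDeformation (n : ℕ) (r : ℝ) {Γ : Subgroup SL(2, ℝ)} {k : ℕ} (q : HolDifferential Γ k)
    (z : ℍ) (v : ℂ) : Matrix (Fin n) (Fin n) ℂ :=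
  operDeformation n q z v + splitInv r z (operDeformation n q z v)

/-! ### Holonomy, eigenvalues and first variations -/

/-- The absolute value of the `p`-th largest (`1 ≤ p ≤ n`, in absolute value, with multiplicity)
eigenvalue. -/
def eigenModulus {n : ℕ} (M : Matrix (Fin n) (Fin n) ℂ) (p : ℕ) : ℝ :=
  ((M.charpoly.roots.map fun x => ‖x‖).sort (· ≥ ·)).getD (p - 1) 0

/-- `T` is the holonomy, i.e. the parallel transport once around, of the connection `d + A` on `E`
along the closed curve `c`, `c (ℓ) = g • c (0)`: `V` is the parallel transport in the frame over
`ℍ`, and the fibre over `c (ℓ)` is identified with the one over `c (0)` by `J(g, c (0))⁻¹`. -/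
def IsHolonomy {n : ℕ} (A : ℍ → ℂ → Matrix (Fin n) (Fin n) ℂ) (g : SL(2, ℝ)) (c : ℝ → ℍ) (ℓ : ℝ)
    (T : Matrix (Fin n) (Fin n) ℂ) : Prop :=
  ∃ V : ℝ → Matrix (Fin n) (Fin n) ℂ, V 0 = 1 ∧
    (∀ s i j, HasDerivAt (fun u => V u i j) ((-(A (c s) (velocity c s) * V s)) i j) s) ∧
    T = (automorphy n g (c 0))⁻¹ * V ℓ

/-- `D + B t` is a `C¹` family of connections on `E → Γ \ ℍ` through the Fuchsian connection `D`
whose derivative at `t = 0` is `ψ + d_D Z` for a section `Z` of `End E`, i.e. equals `ψ` up to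
an infinitesimal gauge transformation. -/
structure IsConnectionVariation {n : ℕ} (Γ : Subgroup SL(2, ℝ)) (r : ℝ)
    (ψ : ℍ → ℂ → Matrix (Fin n) (Fin n) ℂ) (B : ℝ → MatForm n) : Prop where
  endForm : ∀ t, IsEndForm Γ (B t)
  smooth : ∀ v i j, ContDiffOn ℝ 1
    (fun x : ℝ × ℂ => B x.1 (UpperHalfPlane.ofComplex x.2) v i j) {x | 0 < x.2.im}
  zero : B 0 = 0
  tangent : ∃ (Z : ℍ → Matrix (Fin n) (Fin n) ℂ) (dZ : MatForm n),
    IsEndSection Γ Z ∧ HasExtDeriv Z dZ ∧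
    ∀ z v i j, HasDerivAt (fun t => B t z v i j)
      ((ψ z v + (dZ z v + fuchsianForm n r z v * Z z - Z z * fuchsianForm n r z v)) i j) 0

/-- The complex matrix underlying an element of `SL(n, ℝ)`. -/
def toComplexMatrix {n : ℕ} (M : Matrix.SpecialLinearGroup (Fin n) ℝ) :
    Matrix (Fin n) (Fin n) ℂ :=
  (M : Matrix (Fin n) (Fin n) ℝ).map fun x => (x : ℂ)

/-- The curve `δ` of representations `Γ → SL(n, ℝ)` starts at the monodromy of the Fuchsian
connection `D`, and its tangent vector at `t = 0` is the class of the `d_D`-closed form `ψ`.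
Here `G` is a `D`-parallel frame over `ℍ`, with `J(g, z) G(z) = G(g z) δ₀(g)`; the form `G⁻¹ ψ G` is
closed with primitive `P`; and the cocycle of `δ` is the period cocycle
`δ'₀(g) δ₀(g)⁻¹ = P(g z) - δ₀(g) P(z) δ₀(g)⁻¹` of `ψ` (changing `P` by a constant
changes it by a coboundary, which amounts to conjugating the `δ t`). -/
def IsRepVariation {n : ℕ} (Γ : Subgroup SL(2, ℝ)) (r : ℝ)
    (ψ : ℍ → ℂ → Matrix (Fin n) (Fin n) ℂ)
    (δ : ℝ → Γ →* Matrix.SpecialLinearGroup (Fin n) ℝ) : Prop :=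
  ∃ (G P : ℍ → Matrix (Fin n) (Fin n) ℂ) (dG dP : MatForm n),
    (∀ z, IsUnit (G z).det) ∧
    HasExtDeriv G dG ∧ (∀ z v, dG z v + fuchsianForm n r z v * G z = 0) ∧
    (∀ (g : Γ) (z : ℍ),
      G ((g : SL(2, ℝ)) • z) * toComplexMatrix (δ 0 g) = automorphy n (g : SL(2, ℝ)) z * G z) ∧
    HasExtDeriv P dP ∧ (∀ z v, dP z v = (G z)⁻¹ * ψ z v * G z) ∧
    ∀ (g : Γ) (z : ℍ) (i j : Fin n),
      HasDerivAt (fun t => toComplexMatrix (δ t g) i j)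
        ((P ((g : SL(2, ℝ)) • z) * toComplexMatrix (δ 0 g)
          - toComplexMatrix (δ 0 g) * P z) i j) 0

/-- The function `log λ_γ^{(p)}` has first variation `d` at the Fuchsian point in the direction `ψ`,
where `γ` is the closed geodesic given by `g`, `c`, `ℓ`:
along every `C¹` family of connections on `E` (flat or not) and along every curve of representations
`Γ → SL(n, ℝ)` with tangent vector `ψ` at `t = 0`, the derivative at `t = 0` exists and equals `d`.
The holonomy along `γ` of the flat bundle of a representation `δ` (the quotient of `ℍ × ℝⁿ`
by `(z, x) ∼ (g z, δ(g) x)`), i.e. its parallel transport along `γ`, is `δ(g⁻¹)`. -/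
def HasFirstVariation {n : ℕ} (Γ : Subgroup SL(2, ℝ)) (r : ℝ)
    (ψ : ℍ → ℂ → Matrix (Fin n) (Fin n) ℂ) (g : Γ) (c : ℝ → ℍ) (ℓ : ℝ) (p : ℕ) (d : ℝ) : Prop :=
  (∀ B : ℝ → MatForm n, IsConnectionVariation Γ r ψ B →
    ∀ T : ℝ → Matrix (Fin n) (Fin n) ℂ,
      (∀ t, IsHolonomy (fun z v => fuchsianForm n r z v + B t z v) g c ℓ (T t)) →
      HasDerivAt (fun t => Real.log (eigenModulus (T t) p)) d 0) ∧
  (∀ δ : ℝ → Γ →* Matrix.SpecialLinearGroup (Fin n) ℝ, IsRepVariation Γ r ψ δ →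
    HasDerivAt (fun t => Real.log (eigenModulus (toComplexMatrix (δ t g⁻¹)) p)) d 0)

/-- The constant `c_{n,k}^{(p)}`. -/
def gardinerCoeff (n k p : ℕ) : ℝ :=
  ((p - 1).factorial * (n - p).factorial : ℝ) / (2 ^ (k - 2) * (n - k).factorial) *
    ∑ j ∈ Finset.Icc (max 1 (k + p - n)) (min k p),
      ((n - k).choose (p - j) : ℝ) * ((k - 1).choose (j - 1) : ℝ) ^ 2 * (-1) ^ (j + k + 1)

end HitchinVariation

end

/-!
The proof computes the first variation in a frame along the geodesic that is parallel for the
Fuchsian connection `D`.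

Write `c` for the geodesic, `v` for its velocity, `y = Im c`, and let `a` be a square root of
`1 / (r v)`. The geodesic equation reads `a' = i v a / (2 y)`, so after rescaling the frame
`dz ^ ((2 p - n - 1) / 2)` by `diag (a ^ (2 p - n - 1))` the connection form becomes the constant
matrix `(Y + Yᵀ) / √2`. Identifying the `i`-th basis vector with a multiple of `X ^ i`, so that
`√2 Y` acts on polynomials of degree less than `n` as the derivative and `√2 Yᵀ` as
`(n - 1) X - X ^ 2 d/dX`, the eigenvectors of this matrix are the polynomials
`(1 + X) ^ (p - 1) (1 - X) ^ (n - p)`, with eigenvalues `(2 p - n - 1) / 2`. Hence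
`F = diag (a ^ (2 p - n - 1)) · (eigenvectors) · diag (exp (-s (2 p - n - 1) / 2))` is a parallel
frame, and `F ℓ` is `J F 0` times a diagonal matrix `diag d` whose entries have pairwise different
moduli (`exists_parallelFrame`).

For a family of connections or a curve of representations, the holonomy in the frame `F 0` is a
curve of matrices `N t` through `diag d`. Its `p`-th largest eigenvalue is simple, and
`d log |λ_p| = Re (N'_pp / d_p)` (`hasDerivAt_log_eigenModulus`). In both cases this quotient is
`-∫ (F⁻¹ ψ F)_pp ds`: for connections by the first variation of a linear differential equation
(`hasDerivAt_transport`), the gauge term `d_D Z` integrating to a difference of boundary values with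
the same diagonal, and for representations because the period cocycle is the difference of the end
values of a primitive of `ψ`. The diagonal entries of `F⁻¹ ψ F` are the products of
`2 r ^ (k - 1) Re (q v ^ k)` and the diagonal entries of `(√2 Y) ^ (k - 1)` in the eigenbasis
(`parallelFrame_hitchinDeformation_diag`). By the Leibniz rule for the `(k - 1)`-st derivative of
`(1 + X) ^ (p - 1) (1 - X) ^ (n - p)` the latter are the sums in `gardinerCoeff`
(`gardinerCoeff_eq_diagCoeff`).
-/

/-! ### Perturbation of eigenvalues of pairwise different moduli -/

namespace HitchinVariation
open Filter Topology

theorem pow_card_le_prod_map {α : Type*} (R : Multiset α) (f : α → ℝ) {δ : ℝ} (hδ : 0 ≤ δ)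
    (h : ∀ x ∈ R, δ ≤ f x) : δ ^ R.card ≤ (R.map f).prod := by
  induction R using Multiset.induction with
  | empty => simp
  | cons a s ih =>
    rw [Multiset.card_cons, Multiset.map_cons, Multiset.prod_cons, pow_succ']
    exact mul_le_mul (h a (by simp)) (ih fun x hx => h x (by simp [hx])) (by positivity)
      (hδ.trans (h a (by simp)))

theorem charpoly_eval_eq_prod {n : ℕ} (M : Matrix (Fin n) (Fin n) ℂ) (d : ℂ) :
    M.charpoly.eval d = (M.charpoly.roots.map fun x => d - x).prod := by
  have hs := IsAlgClosed.splits M.charpoly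
  conv_lhs => rw [hs.eq_prod_roots_of_monic M.charpoly_monic]
  rw [Polynomial.eval_multiset_prod, Multiset.map_map]
  simp

theorem card_roots_charpoly {n : ℕ} (M : Matrix (Fin n) (Fin n) ℂ) :
    M.charpoly.roots.card = n := by
  have hs := IsAlgClosed.splits M.charpoly
  rw [← hs.natDegree_eq_card_roots, Matrix.charpoly_natDegree_eq_dim, Fintype.card_fin]

/-- If the characteristic polynomial is small at `d`, there is an eigenvalue close to `d`. -/
theorem exists_root_charpoly_near {n : ℕ} (hn : 0 < n) (M : Matrix (Fin n) (Fin n) ℂ) (d : ℂ) :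
    ∃ x ∈ M.charpoly.roots, ‖d - x‖ ^ n ≤ ‖M.charpoly.eval d‖ := by
  classical
  have hcard := card_roots_charpoly M
  have hne : M.charpoly.roots.toFinset.Nonempty := by
    rw [Multiset.toFinset_nonempty]
    rintro h
    rw [h] at hcard
    simp at hcard
    omega
  obtain ⟨x, hx, hmin⟩ := Finset.exists_min_image _ (fun x => ‖d - x‖) hne
  refine ⟨x, by simpa using hx, ?_⟩
  rw [charpoly_eval_eq_prod]
  have h1 := pow_card_le_prod_map M.charpoly.roots (fun x => ‖d - x‖) (norm_nonneg (d - x))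
    fun y hy => hmin y (by simpa using hy)
  rw [hcard] at h1
  have h2 := map_multiset_prod (normHom : ℂ →*₀ ℝ) (M.charpoly.roots.map fun x => d - x)
  rw [Multiset.map_map] at h2
  exact h1.trans h2.symm.le

/-- `n` different eigenvalues exhaust the spectrum, all with multiplicity one. -/
theorem roots_charpoly_eq_map {n : ℕ} (M : Matrix (Fin n) (Fin n) ℂ) (x : Fin n → ℂ)
    (hx : ∀ i, x i ∈ M.charpoly.roots) (hinj : Function.Injective x) :
    M.charpoly.roots = Finset.univ.val.map x := by
  symm
  apply Multiset.eq_of_le_of_card_le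
  · rw [Multiset.le_iff_subset (Multiset.Nodup.map hinj Finset.univ.nodup)]
    intro y hy
    obtain ⟨i, -, rfl⟩ := Multiset.mem_map.1 hy
    exact hx i
  · rw [card_roots_charpoly]; simp

theorem eigenModulus_eq_norm {n : ℕ} (M : Matrix (Fin n) (Fin n) ℂ) (x : Fin n → ℂ)
    (hx : M.charpoly.roots = Finset.univ.val.map x) (hanti : StrictAnti fun i => ‖x i‖)
    (p : Fin n) : eigenModulus M (p.val + 1) = ‖x p‖ := by
  have h1 : (M.charpoly.roots.map fun x => ‖x‖)
      = ((List.ofFn fun i => ‖x i‖ : List ℝ) : Multiset ℝ) := by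
    rw [hx, Multiset.map_map, List.ofFn_eq_map, ← Multiset.map_coe]
    rfl
  have h2 : (M.charpoly.roots.map fun x => ‖x‖).sort (· ≥ ·) = List.ofFn fun i => ‖x i‖ := by
    rw [h1, Multiset.coe_sort]
    apply List.mergeSort_of_pairwise
    rw [List.pairwise_ofFn]
    intro i j hij
    simpa using (hanti hij).le
  rw [eigenModulus, h2]
  simp

theorem eigenModulus_conj {n : ℕ} (M U V : Matrix (Fin n) (Fin n) ℂ) (h : U * V = 1) (p : ℕ) :
    eigenModulus (U * M * V) p = eigenModulus M p := by
  have h' : V * U = 1 := mul_eq_one_comm.1 h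
  have : (U * M * V).charpoly = M.charpoly := by
    have := Matrix.charpoly_units_conj (⟨U, V, h, h'⟩ : (Matrix (Fin n) (Fin n) ℂ)ˣ) M
    rwa [Matrix.inv_eq_right_inv h] at this
  rw [eigenModulus, eigenModulus, this]

theorem continuousAt_charpoly_eval {n : ℕ} {N : ℝ → Matrix (Fin n) (Fin n) ℂ}
    (hN : ∀ i j, ContinuousAt (fun t => N t i j) 0) (z : ℂ) :
    ContinuousAt (fun t => (N t).charpoly.eval z) 0 := by
  have h : (fun t => (N t).charpoly.eval z) = fun t => (Matrix.scalar (Fin n) z - N t).det := by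
    ext t; rw [Matrix.eval_charpoly]
  rw [h]
  have hN' : ContinuousAt N 0 := continuousAt_pi.2 fun i => continuousAt_pi.2 fun j => hN i j
  exact (Continuous.matrix_det continuous_id).continuousAt.comp (continuousAt_const.sub hN')

/-- The derivative of `det (d_p - N t)` at a diagonal matrix: only the diagonal
entry `p` contributes, since row `p` vanishes at `t = 0`. -/
theorem hasDerivAt_charpoly_eval {n : ℕ} {N : ℝ → Matrix (Fin n) (Fin n) ℂ}
    {N' : Matrix (Fin n) (Fin n) ℂ} {d : Fin n → ℂ} (h0 : N 0 = Matrix.diagonal d)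
    (hN : ∀ i j, HasDerivAt (fun t => N t i j) (N' i j) 0) (p : Fin n) :
    HasDerivAt (fun t => (N t).charpoly.eval (d p))
      (-(N' p p) * ∏ i ∈ Finset.univ.erase p, (d p - d i)) 0 := by
  have h : (fun t => (N t).charpoly.eval (d p)) =
      fun t => (Matrix.scalar (Fin n) (d p) - N t).det := by
    ext t; rw [Matrix.eval_charpoly]
  have hM : ∀ i j, HasDerivAt (fun t => (Matrix.scalar (Fin n) (d p) - N t) i j) (-(N' i j)) 0 := by
    intro i j
    exact (hN i j).const_sub (Matrix.scalar (Fin n) (d p) i j)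
  have hM0 : Matrix.scalar (Fin n) (d p) - N 0 = Matrix.diagonal fun i => d p - d i := by
    rw [h0, Matrix.scalar_apply, Matrix.diagonal_sub]
  set M : ℝ → Matrix (Fin n) (Fin n) ℂ := fun t => Matrix.scalar (Fin n) (d p) - N t with hMdef
  rw [h]
  have key : HasDerivAt
      (fun t => ∑ σ : Equiv.Perm (Fin n), (Equiv.Perm.sign σ : ℤ) • ∏ i, M t (σ i) i)
      (∑ σ : Equiv.Perm (Fin n), (Equiv.Perm.sign σ : ℤ) •
        ∑ i, (∏ j ∈ Finset.univ.erase i, M 0 (σ j) j) • (-(N' (σ i) i))) 0 := by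
    apply HasDerivAt.fun_sum
    intro σ _
    exact (HasDerivAt.fun_finsetProd fun i _ => hM (σ i) i).fun_const_smul _
  have h3 : (fun t => (M t).det) =
      fun t => ∑ σ : Equiv.Perm (Fin n), (Equiv.Perm.sign σ : ℤ) • ∏ i, M t (σ i) i := by
    ext t; rw [Matrix.det_apply]; rfl
  rw [h3]
  convert key using 1
  have hM0' : M 0 = Matrix.diagonal fun i => d p - d i := hM0
  rw [hM0', Finset.sum_eq_single 1, Finset.sum_eq_single p]
  · simp [mul_comm]
  · intro i _ hi
    rw [Finset.prod_eq_zero (i := p) (by simp [Ne.symm hi]) (by simp), zero_smul]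
  · simp
  · intro σ _ hσ
    rw [Finset.sum_eq_zero, smul_zero]
    intro i _
    -- a permutation which is not the identity moves at least two indices
    obtain ⟨j, hji, hj⟩ : ∃ j, j ≠ i ∧ σ j ≠ j := by
      by_contra! h
      refine hσ (Equiv.ext fun j => ?_)
      by_cases hj : j = i
      · subst hj
        by_contra hne
        exact hne (σ.injective (h (σ j) hne))
      · exact h j hj
    have h0 : ∏ j ∈ Finset.univ.erase i, Matrix.diagonal (fun i => d p - d i) (σ j) j = 0 :=
      Finset.prod_eq_zero (i := j) (by simp [hji]) (Matrix.diagonal_apply_ne _ hj)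
    exact (congrArg (· • -N' (σ i) i) h0).trans (zero_smul ℂ _)
  · simp

/-- First variation of the moduli of eigenvalues at a diagonal matrix with eigenvalues of
pairwise different moduli. -/
theorem hasDerivAt_log_eigenModulus {n : ℕ} {N : ℝ → Matrix (Fin n) (Fin n) ℂ}
    {N' : Matrix (Fin n) (Fin n) ℂ} {d : Fin n → ℂ} (h0 : N 0 = Matrix.diagonal d)
    (hN : ∀ i j, HasDerivAt (fun t => N t i j) (N' i j) 0)
    (hd : StrictAnti fun i => ‖d i‖) (hd0 : ∀ i, d i ≠ 0) (p : Fin n) :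
    HasDerivAt (fun t => Real.log (eigenModulus (N t) (p.val + 1))) ((N' p p / d p).re) 0 := by
  have hn : 0 < n := p.pos
  have hinj : Function.Injective d := fun i j hij => hd.injective (by simp [hij])
  -- `x t i` is an eigenvalue of `N t` nearest to `d i`
  choose x hxroot hxle using fun t i => exists_root_charpoly_near hn (N t) (d i)
  have hev0 : ∀ i, (N 0).charpoly.eval (d i) = 0 := by
    intro i
    rw [Matrix.eval_charpoly, h0, Matrix.scalar_apply, Matrix.diagonal_sub, Matrix.det_diagonal]
    exact Finset.prod_eq_zero (Finset.mem_univ i) (sub_self _)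
  have hxt : ∀ i, Tendsto (fun t => x t i) (𝓝 0) (𝓝 (d i)) := by
    intro i
    have h1 : Tendsto (fun t => ‖(N t).charpoly.eval (d i)‖) (𝓝 0) (𝓝 0) := by
      have := (continuousAt_charpoly_eval (fun i j => (hN i j).continuousAt) (d i)).norm
      simpa [ContinuousAt, hev0] using this
    have h2 : Tendsto (fun t => ‖d i - x t i‖ ^ n) (𝓝 0) (𝓝 0) :=
      squeeze_zero (fun t => by positivity) (fun t => hxle t i) h1
    have h3 : Tendsto (fun t => ‖d i - x t i‖) (𝓝 0) (𝓝 0) := by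
      have := h2.rpow_const (p := (n : ℝ)⁻¹) (Or.inr (by positivity))
      simpa [Real.pow_rpow_inv_natCast (norm_nonneg _) hn.ne',
        Real.zero_rpow (by positivity : (n : ℝ)⁻¹ ≠ 0)] using this
    rw [tendsto_iff_norm_sub_tendsto_zero]
    simpa [norm_sub_rev] using h3
  have hx0 : ∀ i, x 0 i = d i := by
    intro i
    have := hxle 0 i
    rw [hev0, norm_zero] at this
    have := pow_eq_zero_iff hn.ne' |>.1 (le_antisymm this (by positivity))
    rw [norm_eq_zero, sub_eq_zero] at this
    exact this.symm
  have hanti : ∀ᶠ t in 𝓝 (0 : ℝ), StrictAnti fun i => ‖x t i‖ := by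
    have : ∀ i j : Fin n, ∀ᶠ t in 𝓝 (0 : ℝ), i < j → ‖x t j‖ < ‖x t i‖ := by
      intro i j
      by_cases hij : i < j
      · filter_upwards [(hxt j).norm.eventually_lt (hxt i).norm (hd hij)] with t ht _ using ht
      · exact Eventually.of_forall fun t h => absurd h hij
    have := eventually_all.2 fun i => eventually_all.2 (this i)
    filter_upwards [this] with t ht i j hij using ht i j hij
  have hroots : ∀ᶠ t in 𝓝 (0 : ℝ), (N t).charpoly.roots = Finset.univ.val.map (x t) := by
    filter_upwards [hanti] with t ht
    exact roots_charpoly_eq_map _ _ (hxroot t) fun i j hij => ht.injective (by simp [hij])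
  set g : ℝ → ℂ := fun t => ∏ i ∈ Finset.univ.erase p, (d p - x t i) with hg
  set g0 : ℂ := ∏ i ∈ Finset.univ.erase p, (d p - d i) with hg0
  have hg0ne : g0 ≠ 0 := by
    refine Finset.prod_ne_zero_iff.2 fun i hi => sub_ne_zero.2 fun h => ?_
    exact (Finset.mem_erase.1 hi).1 (hinj h).symm
  have hgt : Tendsto g (𝓝 0) (𝓝 g0) :=
    tendsto_finsetProd _ fun i _ => tendsto_const_nhds.sub (hxt i)
  -- as `charpoly (N t) (d p) = (d p - x t p) * g t`, only continuity of the other eigenvalues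
  -- is needed
  have hxd : HasDerivAt (fun t => x t p) (N' p p) 0 := by
    rw [hasDerivAt_iff_tendsto_slope]
    have h1 := hasDerivAt_iff_tendsto_slope.1 (hasDerivAt_charpoly_eval h0 hN p)
    have h2 := (h1.div (hgt.mono_left nhdsWithin_le_nhds) hg0ne).neg
    have e : -(-(N' p p) * g0 / g0) = N' p p := by field_simp
    rw [e] at h2
    refine h2.congr' ?_
    have hgne : ∀ᶠ t in 𝓝 (0 : ℝ), g t ≠ 0 := hgt.eventually_ne hg0ne
    filter_upwards [nhdsWithin_le_nhds hgne, nhdsWithin_le_nhds hroots, self_mem_nhdsWithin]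
      with t hgt0 hrt ht
    have e2 : (N t).charpoly.eval (d p) = (d p - x t p) * g t := by
      rw [charpoly_eval_eq_prod, hrt, Multiset.map_map, hg]
      exact (Finset.mul_prod_erase Finset.univ (fun i => d p - x t i) (Finset.mem_univ p)).symm
    simp only [Pi.div_apply, slope, vsub_eq_sub, hev0, hx0, e2, Complex.real_smul]
    field_simp
    ring
  -- `log ‖x t p‖` is written with the quotient `x t p / d p`, which is close to `1` and so avoids
  -- the branch cut of the logarithm
  have hmain : HasDerivAt (fun t => Real.log ‖d p‖ + (Complex.log (x t p / d p)).re)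
      ((N' p p / d p).re) 0 := by
    have h1 : HasDerivAt (fun t => x t p / d p) (N' p p / d p) 0 := hxd.div_const _
    have h2 := h1.clog_real (by simp [hx0, div_self (hd0 p)])
    have h3 := (Complex.reCLM.hasFDerivAt.comp_hasDerivAt (0 : ℝ) h2).const_add (Real.log ‖d p‖)
    simpa [hx0, div_self (hd0 p), Function.comp_def] using h3
  refine hmain.congr_of_eventuallyEq ?_
  filter_upwards [hanti, hroots, (hxt p).eventually_ne (hd0 p)] with t h1 h2 h3
  rw [eigenModulus_eq_norm _ _ h2 h1, Complex.log_re, norm_div,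
    Real.log_div (by simpa using h3) (by simpa using hd0 p)]
  ring

end HitchinVariation

/-! ### First variation of a linear differential equation -/

namespace HitchinVariation
open Filter Topology

/-- A bound for a solution of `R' = -C R` with `R 0 = 1`. -/
theorem norm_transport_le {n : ℕ} {C R : ℝ → Matrix (Fin n) (Fin n) ℂ} {ℓ K : ℝ} (hK : 0 ≤ K)
    (hR0 : R 0 = 1)
    (hR : ∀ s i j, HasDerivAt (fun u => R u i j) ((-(C s * R s)) i j) s)
    (hC : ∀ s ∈ Set.Icc 0 ℓ, ∀ i j, ‖C s i j‖ ≤ K) {s : ℝ} (hs : s ∈ Set.Icc 0 ℓ) (i j : Fin n) :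
    ‖R s i j‖ ≤ Real.exp (n * K * ℓ) := by
  set x : ℝ → Fin n → ℂ := fun u k => R u k j with hx
  have hx' : ∀ u, HasDerivAt x (fun k => (-(C u * R u)) k j) u :=
    fun u => hasDerivAt_pi.2 fun k => hR u k j
  have h0 : ‖x 0‖ ≤ 1 := by
    rw [pi_norm_le_iff_of_nonneg zero_le_one]
    intro k
    simp only [hx, hR0, Matrix.one_apply]
    split_ifs <;> simp
  have hb : ∀ u ∈ Set.Ico 0 ℓ, ‖fun k => (-(C u * R u)) k j‖ ≤ (n * K) * ‖x u‖ + 0 := by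
    intro u hu
    rw [add_zero, pi_norm_le_iff_of_nonneg (by positivity)]
    intro k
    rw [Matrix.neg_apply, norm_neg, Matrix.mul_apply]
    refine (norm_sum_le _ _).trans ?_
    calc ∑ m, ‖C u k m * R u m j‖ ≤ ∑ _m : Fin n, K * ‖x u‖ := by
          refine Finset.sum_le_sum fun m _ => ?_
          rw [norm_mul]
          exact mul_le_mul (hC u (Set.Ico_subset_Icc_self hu) k m) (norm_le_pi_norm (x u) m)
            (norm_nonneg _) hK
      _ = (n * K) * ‖x u‖ := by simp [mul_assoc]
  have := norm_le_gronwallBound_of_norm_deriv_right_le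
    (fun u _ => (hx' u).continuousAt.continuousWithinAt)
    (fun u _ => (hx' u).hasDerivWithinAt) h0 hb s hs
  rw [gronwallBound_ε0, one_mul, sub_zero] at this
  refine (norm_le_pi_norm (x s) i).trans (this.trans (Real.exp_le_exp.2 ?_))
  exact mul_le_mul_of_nonneg_left hs.2 (by positivity)

/-- First variation of the solution of `R' = -C_t R`, `R 0 = 1`, at a parameter
where `C_t` vanishes. -/
theorem hasDerivAt_transport {n : ℕ} {C R : ℝ → ℝ → Matrix (Fin n) (Fin n) ℂ}
    {Cdot : ℝ → Matrix (Fin n) (Fin n) ℂ} {ℓ K : ℝ} (hℓ : 0 ≤ ℓ) (hK : 0 ≤ K)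
    (hR0 : ∀ t, R t 0 = 1)
    (hR : ∀ t s i j, HasDerivAt (fun u => R t u i j) ((-(C t s * R t s)) i j) s)
    (hcont : ∀ t i j, Continuous fun s => C t s i j)
    (hC : ∀ t ∈ Set.Icc (-1 : ℝ) 1, ∀ s ∈ Set.Icc 0 ℓ, ∀ i j, ‖C t s i j‖ ≤ K * |t|)
    (hdot : ∀ s i j, HasDerivAt (fun t => C t s i j) (Cdot s i j) 0) (i j : Fin n) :
    R 0 ℓ i j = (1 : Matrix (Fin n) (Fin n) ℂ) i j ∧
    IntervalIntegrable (fun s => Cdot s i j) MeasureTheory.volume 0 ℓ ∧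
    HasDerivAt (fun t => R t ℓ i j) (-∫ s in (0 : ℝ)..ℓ, Cdot s i j) 0 := by
  set M := Real.exp (n * K * ℓ) with hM
  have ht1 : ∀ᶠ t : ℝ in 𝓝 0, t ∈ Set.Icc (-1 : ℝ) 1 := Icc_mem_nhds (by norm_num) (by norm_num)
  have habs : ∀ t ∈ Set.Icc (-1 : ℝ) 1, |t| ≤ 1 := fun t ht => abs_le.2 ht
  have hRM : ∀ t ∈ Set.Icc (-1 : ℝ) 1, ∀ s ∈ Set.Icc 0 ℓ, ∀ i j, ‖R t s i j‖ ≤ M := by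
    intro t ht s hs i j
    refine norm_transport_le hK (hR0 t) (hR t) (fun u hu a b => (hC t ht u hu a b).trans ?_) hs i j
    exact mul_le_of_le_one_right hK (habs t ht)
  have hRc : ∀ t i j, Continuous fun s => R t s i j := fun t i j =>
    continuous_iff_continuousAt.2 fun s => (hR t s i j).continuousAt
  have hCRc : ∀ t i j, Continuous fun s => (C t s * R t s) i j := by
    intro t i j
    simp only [Matrix.mul_apply]
    exact continuous_finsetSum _ fun k _ => (hcont t i k).mul (hRc t k j)
  have hint : ∀ t s i j, R t s i j - (1 : Matrix (Fin n) (Fin n) ℂ) i j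
      = -∫ u in (0 : ℝ)..s, (C t u * R t u) i j := by
    intro t s i j
    have := intervalIntegral.integral_eq_sub_of_hasDerivAt (fun u _ => hR t u i j)
      ((hCRc t i j).neg.intervalIntegrable 0 s)
    rw [hR0] at this
    rw [← this, ← intervalIntegral.integral_neg]
    rfl
  have hCRb : ∀ t ∈ Set.Icc (-1 : ℝ) 1, ∀ s ∈ Set.Icc 0 ℓ, ∀ i j,
      ‖(C t s * R t s) i j‖ ≤ n * (K * |t| * M) := by
    intro t ht s hs i j
    rw [Matrix.mul_apply]
    refine (norm_sum_le _ _).trans ?_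
    calc ∑ k, ‖C t s i k * R t s k j‖ ≤ ∑ _k : Fin n, K * |t| * M := by
          refine Finset.sum_le_sum fun k _ => ?_
          rw [norm_mul]
          exact mul_le_mul (hC t ht s hs i k) (hRM t ht s hs k j) (norm_nonneg _) (by positivity)
      _ = n * (K * |t| * M) := by simp
  -- `R t s → 1` as `t → 0`
  have hR1 : ∀ s ∈ Set.Icc 0 ℓ, ∀ i j,
      Tendsto (fun t => R t s i j) (𝓝 0) (𝓝 ((1 : Matrix (Fin n) (Fin n) ℂ) i j)) := by
    intro s hs i j
    rw [tendsto_iff_norm_sub_tendsto_zero]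
    have hz : Tendsto (fun t : ℝ => n * (K * |t| * M) * |s - 0|) (𝓝 0) (𝓝 0) := by
      have : Continuous fun t : ℝ => n * (K * |t| * M) * |s - 0| := by fun_prop
      simpa using this.tendsto 0
    refine squeeze_zero' (Eventually.of_forall fun t => norm_nonneg _) ?_ hz
    filter_upwards [ht1] with t ht
    rw [hint, norm_neg]
    refine intervalIntegral.norm_integral_le_of_norm_le_const fun u hu => ?_
    rw [Set.uIoc_of_le hs.1] at hu
    exact hCRb t ht u ⟨hu.1.le, hu.2.trans hs.2⟩ i j
  have hC0 : ∀ s ∈ Set.Icc 0 ℓ, ∀ i j, C 0 s i j = 0 := by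
    intro s hs i j
    have := hC 0 (by simp) s hs i j
    simpa using this
  have hR00 : R 0 ℓ i j = (1 : Matrix (Fin n) (Fin n) ℂ) i j := by
    have h1 := hint 0 ℓ i j
    rw [intervalIntegral.integral_congr (g := fun _ => (0 : ℂ))] at h1
    · simpa [sub_eq_zero] using h1
    · intro u hu
      rw [Set.uIcc_of_le hℓ] at hu
      simp [Matrix.mul_apply, hC0 u hu]
  have hpt : ∀ s ∈ Set.Icc 0 ℓ, Tendsto (fun t : ℝ => t⁻¹ • (C t s * R t s) i j) (𝓝[≠] 0)
      (𝓝 (Cdot s i j)) := by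
    intro s hs
    have h1 : ∀ k, Tendsto (fun t : ℝ => t⁻¹ • C t s i k) (𝓝[≠] 0) (𝓝 (Cdot s i k)) := by
      intro k
      have := hasDerivAt_iff_tendsto_slope.1 (hdot s i k)
      refine this.congr fun t => ?_
      simp [slope, hC0 s hs]
    have h2 := tendsto_finsetSum Finset.univ fun k _ =>
      (h1 k).mul ((hR1 s hs k j).mono_left nhdsWithin_le_nhds)
    have e : ∑ k, Cdot s i k * (1 : Matrix (Fin n) (Fin n) ℂ) k j = Cdot s i j := by
      rw [← Matrix.mul_apply, mul_one]
    rw [e] at h2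
    refine h2.congr fun t => ?_
    rw [Matrix.mul_apply, Finset.smul_sum]
    exact Finset.sum_congr rfl fun k _ => by rw [smul_mul_assoc]
  have hCRb' : ∀ t ∈ Set.Icc (-1 : ℝ) 1, t ≠ 0 → ∀ s ∈ Set.Icc 0 ℓ,
      ‖t⁻¹ • (C t s * R t s) i j‖ ≤ n * (K * M) := by
    intro t ht ht0 s hs
    have h1 := hCRb t ht s hs i j
    have h2 : 0 < |t| := abs_pos.2 ht0
    rw [norm_smul, norm_inv, Real.norm_eq_abs, inv_mul_le_iff₀ h2]
    linarith
  have hbound : ∀ᶠ t : ℝ in 𝓝[≠] 0, ∀ᵐ s ∂MeasureTheory.volume, s ∈ Set.uIoc 0 ℓ →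
      ‖t⁻¹ • (C t s * R t s) i j‖ ≤ n * (K * M) := by
    filter_upwards [nhdsWithin_le_nhds ht1, self_mem_nhdsWithin] with t ht ht0
    refine Eventually.of_forall fun s hs => ?_
    rw [Set.uIoc_of_le hℓ] at hs
    exact hCRb' t ht ht0 s ⟨hs.1.le, hs.2⟩
  have hmeas : ∀ t : ℝ, MeasureTheory.AEStronglyMeasurable
      (fun s => t⁻¹ • (C t s * R t s) i j) (MeasureTheory.volume.restrict (Set.uIoc 0 ℓ)) :=
    fun t => ((hCRc t i j).const_smul t⁻¹).aestronglyMeasurable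
  have hptae : ∀ᵐ s ∂MeasureTheory.volume, s ∈ Set.uIoc 0 ℓ →
      Tendsto (fun t : ℝ => t⁻¹ • (C t s * R t s) i j) (𝓝[≠] 0) (𝓝 (Cdot s i j)) := by
    refine Eventually.of_forall fun s hs => ?_
    rw [Set.uIoc_of_le hℓ] at hs
    exact hpt s ⟨hs.1.le, hs.2⟩
  -- dominated convergence for the difference quotients of the integral equation
  have hlim := intervalIntegral.tendsto_integral_filter_of_dominated_convergence
    (fun _ => (n * (K * M) : ℝ)) (Eventually.of_forall hmeas) hbound
    intervalIntegrable_const hptae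
  refine ⟨hR00, ?_, ?_⟩
  · have hptae' := (MeasureTheory.ae_restrict_iff' measurableSet_uIoc).2 hptae
    have hm := aestronglyMeasurable_of_tendsto_ae (𝓝[≠] (0 : ℝ)) hmeas hptae'
    refine (intervalIntegrable_const (c := (n * (K * M) : ℝ))).mono_fun' hm ?_
    refine (MeasureTheory.ae_restrict_iff' measurableSet_uIoc).2 (Eventually.of_forall ?_)
    intro s hs
    rw [Set.uIoc_of_le hℓ] at hs
    refine le_of_tendsto (hpt s ⟨hs.1.le, hs.2⟩).norm ?_
    filter_upwards [nhdsWithin_le_nhds ht1, self_mem_nhdsWithin] with t ht ht0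
    exact hCRb' t ht ht0 s ⟨hs.1.le, hs.2⟩
  · rw [hasDerivAt_iff_tendsto_slope]
    refine hlim.neg.congr fun t => ?_
    rw [slope, hR00, sub_zero, vsub_eq_sub, hint, intervalIntegral.integral_smul, smul_neg]

end HitchinVariation

/-! ### The spectrum of `Y + Yᵀ`, through polynomials -/

namespace HitchinVariation
open Polynomial

/-- The matrix of `√2 Y`, with real entries `√(i (n - i))`, `i = 1, …, n - 1`, above the
diagonal. -/
noncomputable def raise (n : ℕ) : Matrix (Fin n) (Fin n) ℝ := fun i j =>
  if j.val = i.val + 1 then √(((i.val : ℝ) + 1) * ((n : ℝ) - ((i.val : ℝ) + 1))) else 0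

/-- The vector of normalized coefficients of a polynomial of degree less than `n`: its `i`-th
entry is the coefficient of `X ^ i` divided by `√((n-1).choose i)`. -/
noncomputable def coeffVec (n : ℕ) : ℝ[X] →ₗ[ℝ] (Fin n → ℝ) where
  toFun p := fun i => p.coeff i / √((n - 1).choose i)
  map_add' p q := by ext i; simp [add_div]
  map_smul' a p := by ext i; simp [mul_div_assoc]

theorem coeffVec_apply (n : ℕ) (p : ℝ[X]) (i : Fin n) :
    coeffVec n p i = p.coeff i / √((n - 1).choose i) := rfl

theorem choose_pred_mul_sub {n i : ℕ} (hi : i + 1 < n) :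
    ((n - 1).choose (i + 1) : ℝ) * (i + 1) = (n - 1).choose i * ((n : ℝ) - (i + 1)) := by
  have h := Nat.choose_succ_right_eq (n - 1) i
  have h2 : ((n - 1 - i : ℕ) : ℝ) = (n : ℝ) - (i + 1) := by
    rw [Nat.cast_sub (by omega), Nat.cast_sub (by omega)]; push_cast; ring
  rw [← h2]
  exact_mod_cast h

/-- The normalization of `coeffVec` turns the entries of `√2 Y` into the factors of the
derivative. -/
theorem raise_weight_choose {n i : ℕ} (hi : i + 1 < n) :
    √(((i : ℝ) + 1) * ((n : ℝ) - (i + 1))) * √((n - 1).choose i)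
      = (i + 1) * √((n - 1).choose (i + 1)) := by
  have hpos : (0 : ℝ) ≤ (i : ℝ) + 1 := by positivity
  rw [← Real.sqrt_mul' _ (by positivity), mul_assoc, mul_comm ((n : ℝ) - _),
    ← choose_pred_mul_sub hi, mul_comm (_ : ℝ) ((i : ℝ) + 1), ← mul_assoc,
    Real.sqrt_mul (by positivity),
    Real.sqrt_mul_self hpos]

theorem raise_weight_choose_succ {n i : ℕ} (hi : i + 1 < n) :
    √(((i : ℝ) + 1) * ((n : ℝ) - (i + 1))) * √((n - 1).choose (i + 1))
      = ((n : ℝ) - (i + 1)) * √((n - 1).choose i) := by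
  have hpos : (0 : ℝ) ≤ (n : ℝ) - (i + 1) := by
    have : ((i + 1 : ℕ) : ℝ) ≤ n := by exact_mod_cast hi.le
    push_cast at this; linarith
  rw [← Real.sqrt_mul' _ (by positivity), mul_comm ((i : ℝ) + 1), mul_assoc, mul_comm ((i : ℝ) + 1),
    choose_pred_mul_sub hi, mul_comm (_ : ℝ) ((n : ℝ) - _), ← mul_assoc,
    Real.sqrt_mul (by positivity), Real.sqrt_mul_self hpos]

theorem sqrt_choose_ne_zero {n i : ℕ} (hi : i < n) : √((n - 1).choose i : ℝ) ≠ 0 := by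
  have : 0 < (n - 1).choose i := Nat.choose_pos (by omega)
  positivity

/-- On polynomials, `√2 Y` acts as the derivative. -/
theorem raise_mulVec_coeffVec {n : ℕ} {p : ℝ[X]} (hp : p.natDegree < n) :
    (raise n).mulVec (coeffVec n p) = coeffVec n (derivative p) := by
  ext i
  rw [Matrix.mulVec, dotProduct, coeffVec_apply, coeff_derivative]
  by_cases hi : i.val + 1 < n
  · rw [Finset.sum_eq_single ⟨i.val + 1, hi⟩]
    · simp only [raise, coeffVec_apply, if_true]
      have h1 := sqrt_choose_ne_zero hi
      have h2 := sqrt_choose_ne_zero i.2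
      rw [mul_div_assoc', div_eq_div_iff h1 h2]
      linear_combination p.coeff (i.val + 1) * raise_weight_choose hi
    · intro j _ hj
      rw [raise, if_neg (fun h => hj (Fin.ext h)), zero_mul]
    · simp
  · rw [Finset.sum_eq_zero, coeff_eq_zero_of_natDegree_lt (by omega)]
    · simp
    · intro j _
      rw [raise, if_neg (by omega), zero_mul]

/-- On polynomials, the transpose of `√2 Y` acts as `(n - 1) X - X ^ 2 d/dX`. -/
theorem raise_transpose_mulVec_coeffVec {n : ℕ} (p : ℝ[X]) :
    (raise n).transpose.mulVec (coeffVec n p) =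
      coeffVec n (X * (C ((n : ℝ) - 1) * p - X * derivative p)) := by
  ext i
  rw [Matrix.mulVec, dotProduct, coeffVec_apply]
  obtain ⟨i, hi⟩ := i
  cases i with
  | zero =>
    rw [Finset.sum_eq_zero]
    · simp
    · intro j _
      rw [Matrix.transpose_apply, raise, if_neg (by simp), zero_mul]
  | succ i =>
    rw [Finset.sum_eq_single ⟨i, by omega⟩]
    · simp only [raise, Matrix.transpose_apply, coeffVec_apply, if_true, coeff_X_mul, coeff_sub,
        coeff_C_mul]
      have h1 := sqrt_choose_ne_zero hi
      have h2 := sqrt_choose_ne_zero (show i < n by omega)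
      have h3 : (X * derivative p).coeff i = i * p.coeff i := by
        cases i with
        | zero => simp
        | succ i => rw [coeff_X_mul, coeff_derivative]; push_cast; ring
      rw [h3, mul_div_assoc', div_eq_div_iff h2 h1]
      linear_combination p.coeff i * raise_weight_choose_succ hi
    · intro j _ hj
      rw [Matrix.transpose_apply, raise, if_neg, zero_mul]
      intro h
      exact hj (Fin.ext (by simpa using h.symm))
    · simp

/-- The polynomial `(1 + X) ^ a (1 - X) ^ (n - 1 - a)`, an eigenvector of `√2 (Y + Yᵀ)`. -/
noncomputable def eigenPoly (n a : ℕ) : ℝ[X] := (X + C 1) ^ a * (1 - X) ^ (n - 1 - a)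

theorem natDegree_eigenPoly_lt {n a : ℕ} (ha : a < n) : (eigenPoly n a).natDegree < n := by
  have h1 : (X + C (1 : ℝ)).natDegree ≤ 1 := by compute_degree
  have h2 : (1 - X : ℝ[X]).natDegree ≤ 1 := by compute_degree
  have h3 : (eigenPoly n a).natDegree ≤ a * 1 + (n - 1 - a) * 1 :=
    natDegree_mul_le_of_le (natDegree_pow_le_of_le a h1) (natDegree_pow_le_of_le _ h2)
  omega

/-- The eigenvalue equation of `√2 (Y + Yᵀ)` for `eigenPoly n a`. -/
theorem eigenPoly_differential_eq {n a : ℕ} (ha : a < n) :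
    derivative (eigenPoly n a)
        + X * (C ((n : ℝ) - 1) * eigenPoly n a - X * derivative (eigenPoly n a))
      = C ((weight n ⟨a, ha⟩ : ℤ) : ℝ) * eigenPoly n a := by
  obtain ⟨b, rfl⟩ : ∃ b, n = a + b + 1 := ⟨n - a - 1, by omega⟩
  have e : a + b + 1 - 1 - a = b := by omega
  have hu : (X + 1 : ℝ[X]) * (C (a : ℝ) * (X + 1) ^ (a - 1)) = C (a : ℝ) * (X + 1) ^ a := by
    cases a with
    | zero => simp
    | succ a => simp [pow_succ]; ring
  have hw : (1 - X : ℝ[X]) * (C (b : ℝ) * (1 - X) ^ (b - 1)) = C (b : ℝ) * (1 - X) ^ b := by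
    cases b with
    | zero => simp
    | succ b => simp [pow_succ]; ring
  simp only [eigenPoly, e, weight, derivative_mul, derivative_pow, derivative_add, derivative_sub,
    derivative_X, derivative_one, map_one]
  push_cast
  simp only [C_add, C_sub, C_mul, map_natCast, map_ofNat, map_one] at hu hw ⊢
  linear_combination (1 - X) * (1 - X) ^ b * hu - (X + 1) * (X + 1) ^ a * hw

/-- The matrix whose columns are the eigenvectors of `√2 (Y + Yᵀ)`. -/
noncomputable def eigenMatrix (n : ℕ) : Matrix (Fin n) (Fin n) ℝ := fun i a =>
  coeffVec n (eigenPoly n a) i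

theorem raise_add_transpose_mul_eigenMatrix (n : ℕ) :
    (raise n + (raise n).transpose) * eigenMatrix n
      = eigenMatrix n * Matrix.diagonal fun a => (weight n a : ℝ) := by
  ext i a
  have h : ((raise n + (raise n).transpose) * eigenMatrix n) i a
      = (raise n + (raise n).transpose).mulVec (coeffVec n (eigenPoly n a)) i := rfl
  rw [h, Matrix.add_mulVec, raise_mulVec_coeffVec (natDegree_eigenPoly_lt a.2),
    raise_transpose_mulVec_coeffVec, ← map_add, eigenPoly_differential_eq a.2, ← smul_eq_C_mul,
    map_smul, Matrix.mul_diagonal, mul_comm]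
  rfl

theorem weight_strictMono (n : ℕ) : StrictMono (weight n) := by
  intro i j hij
  have : (i.val : ℤ) < j.val := by exact_mod_cast hij
  simp only [weight]
  omega

/-- The squared norm of the `a`-th column of `eigenMatrix n`. -/
noncomputable def eigenNorm (n : ℕ) (a : Fin n) : ℝ :=
  ((eigenMatrix n).transpose * eigenMatrix n) a a

theorem eigenNorm_ne_zero {n : ℕ} (a : Fin n) : eigenNorm n a ≠ 0 := by
  have h0 : eigenMatrix n ⟨0, a.pos⟩ a = 1 := by
    simp [eigenMatrix, coeffVec_apply, eigenPoly, coeff_zero_eq_eval_zero]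
  rw [eigenNorm, Matrix.mul_apply]
  refine (Finset.sum_pos' (fun i _ => mul_self_nonneg (eigenMatrix n i a))
    ⟨⟨0, a.pos⟩, Finset.mem_univ _, ?_⟩).ne'
  rw [h0]; norm_num

/-- Eigenvectors of a symmetric matrix with different eigenvalues are orthogonal. -/
theorem eigenMatrix_transpose_mul_self (n : ℕ) :
    (eigenMatrix n).transpose * eigenMatrix n = Matrix.diagonal (eigenNorm n) := by
  set P := eigenMatrix n
  set S := raise n + (raise n).transpose with hS
  have h1 : S * P = P * Matrix.diagonal fun a => (weight n a : ℝ) :=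
    raise_add_transpose_mul_eigenMatrix n
  have hSt : S.transpose = S := by
    rw [hS, Matrix.transpose_add, Matrix.transpose_transpose, add_comm]
  have h2 : P.transpose * S = (Matrix.diagonal fun a => (weight n a : ℝ)) * P.transpose := by
    have := congrArg Matrix.transpose h1
    rwa [Matrix.transpose_mul, Matrix.transpose_mul, hSt, Matrix.diagonal_transpose] at this
  have h3 : (P.transpose * P) * (Matrix.diagonal fun a => (weight n a : ℝ))
      = (Matrix.diagonal fun a => (weight n a : ℝ)) * (P.transpose * P) := by
    rw [mul_assoc, ← h1, ← mul_assoc, h2, mul_assoc]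
  ext a b
  by_cases hab : a = b
  · subst hab; rw [Matrix.diagonal_apply_eq]; rfl
  · rw [Matrix.diagonal_apply_ne _ hab]
    have h4 := congrFun (congrFun h3 a) b
    rw [Matrix.mul_diagonal, Matrix.diagonal_mul] at h4
    have h5 : (weight n b : ℝ) - weight n a ≠ 0 := by
      rw [sub_ne_zero]
      exact fun h => hab ((weight_strictMono n).injective (by exact_mod_cast h)).symm
    have h6 : ((weight n b : ℝ) - weight n a) * (P.transpose * P) a b = 0 := by
      linear_combination h4
    exact (mul_eq_zero.1 h6).resolve_left h5

/-- The inverse of `eigenMatrix n`. The eigenvectors are orthogonal, so it is the transpose up to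
the squared norms. -/
noncomputable def eigenMatrixInv (n : ℕ) : Matrix (Fin n) (Fin n) ℝ :=
  (Matrix.diagonal fun a => (eigenNorm n a)⁻¹) * (eigenMatrix n).transpose

theorem eigenMatrixInv_mul (n : ℕ) : eigenMatrixInv n * eigenMatrix n = 1 := by
  rw [eigenMatrixInv, mul_assoc, eigenMatrix_transpose_mul_self, Matrix.diagonal_mul_diagonal]
  simp [eigenNorm_ne_zero]

/-- The eigenbasis being orthogonal, a matrix and its transpose have the same diagonal in it. -/
theorem eigenMatrixInv_mul_transpose_diag {n : ℕ} (M : Matrix (Fin n) (Fin n) ℝ) (a : Fin n) :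
    (eigenMatrixInv n * M.transpose * eigenMatrix n) a a
      = (eigenMatrixInv n * M * eigenMatrix n) a a := by
  simp only [eigenMatrixInv, mul_assoc, Matrix.diagonal_mul]
  congr 1
  rw [← Matrix.transpose_apply (_ * _), Matrix.transpose_mul, Matrix.transpose_mul,
    Matrix.transpose_transpose, Matrix.transpose_transpose, mul_assoc]

theorem raise_pow_mulVec_coeffVec {n : ℕ} (m : ℕ) {p : ℝ[X]} (hp : p.natDegree < n) :
    (raise n ^ m).mulVec (coeffVec n p) = coeffVec n (derivative^[m] p) := by
  induction m generalizing p with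
  | zero => simp
  | succ m ih =>
    rw [pow_succ, ← Matrix.mulVec_mulVec, raise_mulVec_coeffVec hp, ih, Function.iterate_succ_apply]
    exact (natDegree_derivative_le p).trans_lt (by omega)

/-- The coordinate functional dual to the eigenvector `a`. -/
noncomputable def dualFunctional (n : ℕ) (a : Fin n) : ℝ[X] →ₗ[ℝ] ℝ :=
  (LinearMap.proj a).comp ((eigenMatrixInv n).mulVecLin.comp (coeffVec n))

theorem dualFunctional_apply (n : ℕ) (a : Fin n) (p : ℝ[X]) :
    dualFunctional n a p = (eigenMatrixInv n).mulVec (coeffVec n p) a := rfl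

theorem dualFunctional_eigenPoly {n : ℕ} (a : Fin n) {b : ℕ} (hb : b < n) :
    dualFunctional n a (eigenPoly n b) = if b = a.val then 1 else 0 := by
  have : dualFunctional n a (eigenPoly n b) = (eigenMatrixInv n * eigenMatrix n) a ⟨b, hb⟩ := rfl
  rw [this, eigenMatrixInv_mul, Matrix.one_apply]
  simp only [Fin.ext_iff, eq_comm]

theorem raise_pow_diag {n : ℕ} (m : ℕ) (a : Fin n) :
    (eigenMatrixInv n * raise n ^ m * eigenMatrix n) a a
      = dualFunctional n a (derivative^[m] (eigenPoly n a)) := by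
  rw [dualFunctional_apply, ← raise_pow_mulVec_coeffVec m (natDegree_eigenPoly_lt a.2),
    Matrix.mulVec_mulVec]
  rfl

theorem iterate_derivative_eigenPoly (n a m : ℕ) :
    derivative^[m] (eigenPoly n a) = ∑ j ∈ Finset.range (m + 1),
      (((m.choose j : ℝ) * (a.descFactorial j) * ((n - 1 - a).descFactorial (m - j))
        * (-1) ^ (m - j)) • ((X + C 1) ^ (a - j) * (1 - X) ^ (n - 1 - a - (m - j))) : ℝ[X]) := by
  have h1 : ∀ b i : ℕ, derivative^[i] ((1 - X : ℝ[X]) ^ b)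
      = ((-1) ^ i * (b.descFactorial i : ℝ)) • (1 - X : ℝ[X]) ^ (b - i) := by
    intro b i
    have := iterate_derivative_comp_one_sub_X (X ^ b : ℝ[X]) i
    rw [X_pow_comp, iterate_derivative_X_pow_eq_smul] at this
    rw [this, smul_comp, X_pow_comp, smul_eq_C_mul, smul_eq_C_mul]
    simp
    ring
  rw [eigenPoly, iterate_derivative_mul, ← Finset.sum_range_reflect]
  refine Finset.sum_congr rfl fun j hj => ?_
  have hj' : j ≤ m := by simpa [Nat.lt_succ_iff] using hj
  have e1 : m + 1 - 1 - j = m - j := by omega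
  have e2 : m - (m - j) = j := by omega
  rw [e1, e2, h1, iterate_derivative_X_add_pow, Nat.choose_symm hj']
  simp only [smul_eq_C_mul, nsmul_eq_mul, C_mul, C_pow, C_neg, C_1, map_natCast]
  ring

/-- The diagonal coefficients of `(√2 Y) ^ m` in the eigenbasis of `Y + Yᵀ`. -/
noncomputable def diagCoeff (n m a : ℕ) : ℝ :=
  (2 ^ m)⁻¹ * ∑ j ∈ Finset.range (m + 1), (m.choose j : ℝ) ^ 2 * (a.descFactorial j) *
    ((n - 1 - a).descFactorial (m - j)) * (-1) ^ (m - j)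

/-- Multiplying by `1 = ((1 + X) + (1 - X)) ^ m / 2 ^ m` brings the terms of the Leibniz rule back
to degree `n - 1`; the coefficient of `eigenPoly n a` is then a binomial coefficient. -/
theorem dualFunctional_mul_pow {n : ℕ} (a : Fin n) {m j : ℕ} (hjm : j ≤ m) (hja : j ≤ a)
    (hjb : m - j ≤ n - 1 - a) :
    dualFunctional n a ((X + C 1) ^ (a.val - j) * (1 - X) ^ (n - 1 - a - (m - j)))
      = (2 ^ m)⁻¹ * m.choose j := by
  have ha := a.2
  set Q : ℝ[X] := (X + C 1) ^ (a.val - j) * (1 - X) ^ (n - 1 - a - (m - j)) with hQ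
  have h1 : Q = ((2 : ℝ) ^ m)⁻¹ • (((X + C 1) + (1 - X)) ^ m * Q) := by
    have : (X + C 1) + (1 - X) = C (2 : ℝ) := by
      rw [C_1, map_ofNat]; ring
    rw [this, ← C_pow, ← smul_eq_C_mul, smul_smul, inv_mul_cancel₀ (by positivity), one_smul]
  rw [h1, add_pow, Finset.sum_mul, map_smul, map_sum, smul_eq_mul]
  congr 1
  have hterm : ∀ i ≤ m, (X + C 1) ^ i * (1 - X) ^ (m - i) * (m.choose i : ℝ[X]) * Q
      = (m.choose i : ℝ) • eigenPoly n (a - j + i) := by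
    intro i hi
    rw [smul_eq_C_mul, map_natCast, eigenPoly, pow_add, hQ,
      show n - 1 - (a.val - j + i) = (m - i) + (n - 1 - a - (m - j)) by omega, pow_add]
    ring
  rw [Finset.sum_eq_single j]
  · rw [hterm j hjm, map_smul, dualFunctional_eigenPoly a (by omega), if_pos (by omega)]
    simp
  · intro i hi hij
    have hi' : i ≤ m := by simpa [Nat.lt_succ_iff] using hi
    rw [hterm i hi', map_smul, dualFunctional_eigenPoly a (by omega), if_neg (by omega), smul_zero]
  · intro h
    simp at h
    omega

theorem raise_pow_diag_eq {n : ℕ} (m : ℕ) (a : Fin n) :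
    (eigenMatrixInv n * raise n ^ m * eigenMatrix n) a a = diagCoeff n m a := by
  rw [raise_pow_diag, iterate_derivative_eigenPoly, map_sum, diagCoeff, Finset.mul_sum]
  refine Finset.sum_congr rfl fun j hj => ?_
  have hj' : j ≤ m := by simpa [Nat.lt_succ_iff] using hj
  rw [map_smul, smul_eq_mul]
  by_cases h1 : j ≤ a
  · by_cases h2 : m - j ≤ n - 1 - a
    · rw [dualFunctional_mul_pow a hj' h1 h2]; ring
    · rw [Nat.descFactorial_of_lt (not_le.1 h2)]; simp
  · rw [Nat.descFactorial_of_lt (not_le.1 h1)]; simp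

theorem gardinerCoeff_eq_diagCoeff {n k p : ℕ} (hk : 2 ≤ k) (hkn : k ≤ n) (hp : 1 ≤ p)
    (hpn : p ≤ n) : gardinerCoeff n k p = -2 * diagCoeff n (k - 1) (p - 1) := by
  obtain ⟨m, rfl⟩ : ∃ m, k = m + 2 := ⟨k - 2, by omega⟩
  obtain ⟨a, rfl⟩ : ∃ a, p = a + 1 := ⟨p - 1, by omega⟩
  set f : ℕ → ℝ := fun j => ((m + 1).choose j : ℝ) ^ 2 * (a.descFactorial j) *
    ((n - 1 - a).descFactorial (m + 1 - j)) * (-1) ^ (m + 1 - j) with hf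
  have hR : diagCoeff n (m + 2 - 1) (a + 1 - 1)
      = (2 ^ (m + 1))⁻¹ * ∑ j ∈ Finset.Icc 1 (m + 2), f (j - 1) := by
    rw [diagCoeff, show Finset.Icc 1 (m + 2) = Finset.Ico 1 (m + 3) from rfl,
      Finset.sum_Ico_eq_sum_range]
    simp only [hf, Nat.add_sub_cancel, Nat.add_sub_cancel_left]
    rfl
  have hsub : ∑ j ∈ Finset.Icc (max 1 (m + 2 + (a + 1) - n)) (min (m + 2) (a + 1)), f (j - 1)
      = ∑ j ∈ Finset.Icc 1 (m + 2), f (j - 1) := by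
    refine Finset.sum_subset (fun j hj => ?_) fun j hj hj' => ?_
    · simp only [Finset.mem_Icc, max_le_iff, le_min_iff] at hj ⊢
      omega
    · simp only [Finset.mem_Icc, max_le_iff, le_min_iff, not_and_or] at hj hj'
      have : a < j - 1 ∨ n - 1 - a < m + 1 - (j - 1) := by omega
      rcases this with h | h
      · simp [hf, Nat.descFactorial_of_lt h]
      · simp [hf, Nat.descFactorial_of_lt h]
  rw [hR, ← hsub, gardinerCoeff, Finset.mul_sum, Finset.mul_sum, Finset.mul_sum]
  refine Finset.sum_congr rfl fun j hj => ?_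
  simp only [Finset.mem_Icc, max_le_iff, le_min_iff] at hj
  obtain ⟨i, rfl⟩ : ∃ i, j = i + 1 := ⟨j - 1, by omega⟩
  have h1 : (a - i).factorial * a.descFactorial i = a.factorial :=
    Nat.factorial_mul_descFactorial (by omega)
  have h2 : (n - 1 - a - (m + 1 - i)).factorial * (n - 1 - a).descFactorial (m + 1 - i)
      = (n - 1 - a).factorial := Nat.factorial_mul_descFactorial (by omega)
  have h3 := Nat.choose_mul_factorial_mul_factorial (show a - i ≤ n - (m + 2) by omega)
  have e1 : n - (m + 2) - (a - i) = n - 1 - a - (m + 1 - i) := by omega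
  have e2 : n - (a + 1) = n - 1 - a := by omega
  have e3 : (-1 : ℝ) ^ (i + 1 + (m + 2) + 1) = -(-1) ^ (m + 1 - i) := by
    rw [show i + 1 + (m + 2) + 1 = (m + 1 - i) + 2 * (i + 1) + 1 by omega, pow_succ, pow_add,
      pow_mul]
    simp
  rw [e1] at h3
  simp only [hf, Nat.add_sub_cancel, Nat.add_sub_add_right, e2, e3]
  rw [← h1, ← h2, ← h3]
  push_cast
  have : ∀ x : ℕ, (x.factorial : ℝ) ≠ 0 := fun x => by exact_mod_cast x.factorial_ne_zero
  have hc : ((n - (m + 2)).choose (a - i) : ℝ) ≠ 0 := by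
    exact_mod_cast (Nat.choose_pos (by omega)).ne'
  have hf1 := this (a - i)
  have hf2 := this (n - 1 - a - (m + 1 - i))
  field_simp
  ring

theorem gardinerCoeff_one {n k : ℕ} (hk : 2 ≤ k) (hkn : k ≤ n) :
    gardinerCoeff n k 1
      = (-1) ^ k * ((n - 1).factorial : ℝ) / (2 ^ (k - 2) * (n - k).factorial) := by
  have e : Finset.Icc (max 1 (k + 1 - n)) (min k 1) = {1} := by
    rw [max_eq_left (by omega), min_eq_right (by omega), Finset.Icc_self]
  rw [gardinerCoeff, e, Finset.sum_singleton, show 1 + k + 1 = k + 2 by omega, pow_add]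
  simp
  ring

theorem gardinerCoeff_self {n p : ℕ} (hn : 2 ≤ n) (hp : 1 ≤ p) (hpn : p ≤ n) :
    gardinerCoeff n n p = (-1) ^ (p + n + 1) * (((n - 1).factorial : ℝ) / 2 ^ (n - 2)) *
      ((n - 1).choose (p - 1) : ℝ) := by
  have e : Finset.Icc (max 1 (n + p - n)) (min n p) = {p} := by
    rw [max_eq_right (by omega), min_eq_right (by omega), Nat.add_sub_cancel_left, Finset.Icc_self]
  have h := Nat.choose_mul_factorial_mul_factorial (show p - 1 ≤ n - 1 by omega)
  rw [show n - 1 - (p - 1) = n - p by omega] at h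
  rw [gardinerCoeff, e, Finset.sum_singleton, ← h]
  push_cast
  simp
  ring

end HitchinVariation

/-! ### Geodesics of the upper half plane -/

namespace HitchinVariation
open Complex

/-- The unit speed parametrization `s ↦ i e ^ s` of the imaginary half axis. -/
noncomputable def axisPoint (s : ℝ) : ℍ :=
  ⟨I * (Real.exp s : ℂ), by simp [-ofReal_exp, Real.exp_pos]⟩

theorem coe_axisPoint (s : ℝ) : (axisPoint s : ℂ) = I * (Real.exp s : ℂ) := rfl

theorem axisPoint_re (s : ℝ) : (axisPoint s).re = 0 := by
  rw [← UpperHalfPlane.coe_re, coe_axisPoint]; simp [-ofReal_exp]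

theorem axisPoint_im (s : ℝ) : (axisPoint s).im = Real.exp s := by
  rw [← UpperHalfPlane.coe_im, coe_axisPoint]; simp [-ofReal_exp]

theorem coe_sl2_smul (g : SL(2, ℝ)) (z : ℍ) :
    ((g • z : ℍ) : ℂ) = ((g 0 0 : ℂ) * z + g 0 1) / ((g 1 0 : ℂ) * z + g 1 1) := by
  simpa using UpperHalfPlane.coe_specialLinearGroup_apply g z

theorem sl2_det_eq (g : SL(2, ℝ)) : g 0 0 * g 1 1 - g 0 1 * g 1 0 = 1 := by
  have := g.det_coe
  rwa [Matrix.det_fin_two] at this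

theorem autFactor_ne_zero (g : SL(2, ℝ)) (z : ℍ) : autFactor g z ≠ 0 := by
  intro h
  have hz := z.im_pos
  have h1 := congrArg Complex.im h
  have h2 := congrArg Complex.re h
  simp [autFactor] at h1 h2
  have hd := sl2_det_eq g
  rcases h1 with h1 | h1
  · rw [h1] at h2 hd
    simp at h2
    rw [h2] at hd
    simp at hd
  · exact hz.ne' h1

/-- The chain rule for the action of `SL(2, ℝ)` along a curve. -/
theorem hasDerivAt_sl2_smul (g : SL(2, ℝ)) {c : ℝ → ℍ} {v : ℂ} {s : ℝ}
    (hc : HasDerivAt (fun u => (c u : ℂ)) v s) :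
    HasDerivAt (fun u => ((g • c u : ℍ) : ℂ)) (mobiusDeriv g (c s) * v) s := by
  have hd : (g 1 0 : ℂ) * c s + g 1 1 ≠ 0 := autFactor_ne_zero g (c s)
  have hdet : (g 0 0 * g 1 1 - g 0 1 * g 1 0 : ℂ) = 1 := by exact_mod_cast sl2_det_eq g
  have h1 := ((hc.const_mul (g 0 0 : ℂ)).add_const (g 0 1 : ℂ)).div
    ((hc.const_mul (g 1 0 : ℂ)).add_const (g 1 1 : ℂ)) hd
  have h2 : (fun u => ((g • c u : ℍ) : ℂ))
      = fun u => ((g 0 0 : ℂ) * c u + g 0 1) / ((g 1 0 : ℂ) * c u + g 1 1) :=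
    funext fun u => coe_sl2_smul g (c u)
  rw [h2]
  refine h1.congr_deriv ?_
  rw [mobiusDeriv, autFactor]
  field_simp
  linear_combination v * hdet

/-- The equation of the hyperbolic circle of radius `|s - t|` about `i e ^ t`. -/
theorem circle_equation {w : ℍ} {s t : ℝ} (h : dist (axisPoint t) w = |s - t|) :
    w.re ^ 2 + w.im ^ 2 + Real.exp t ^ 2
      = w.im * (Real.exp s + Real.exp t ^ 2 * Real.exp (-s)) := by
  have h1 := UpperHalfPlane.cosh_dist' (axisPoint t) w
  rw [h, Real.cosh_abs, axisPoint_re, axisPoint_im, Real.cosh_eq, neg_sub, Real.exp_sub,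
    Real.exp_sub, Real.exp_neg] at *
  have hw := w.im_pos
  have := Real.exp_pos t
  have := Real.exp_pos s
  field_simp at h1 ⊢
  linear_combination (-1 : ℝ) * h1

/-- A point on the two circles through `i e ^ s` about `i` and `i e` is `i e ^ s`. -/
theorem eq_axisPoint {w : ℍ} {s : ℝ} (h0 : dist (axisPoint 0) w = |s|)
    (h1 : dist (axisPoint 1) w = |s - 1|) : w = axisPoint s := by
  have e0 := circle_equation (w := w) (s := s) (t := 0) (by simpa using h0)
  have e1 := circle_equation h1
  rw [Real.exp_zero] at e0
  have hE : (1 : ℝ) < Real.exp 1 := by simp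
  have hs := Real.exp_pos s
  have hsn : Real.exp s * Real.exp (-s) = 1 := by rw [← Real.exp_add]; simp
  have him : w.im = Real.exp s := by
    have : (Real.exp 1 ^ 2 - 1) * (w.im * Real.exp (-s) - 1) = 0 := by linear_combination e0 - e1
    have h2 : w.im * Real.exp (-s) - 1 = 0 := by
      refine (mul_eq_zero.1 this).resolve_left ?_
      nlinarith
    linear_combination Real.exp s * h2 - w.im * hsn
  have hre : w.re = 0 := by
    rw [him] at e0
    have : w.re ^ 2 = 0 := by linear_combination e0 + hsn
    exact pow_eq_zero_iff (two_ne_zero) |>.1 this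
  exact UpperHalfPlane.ext_re_im (by rw [hre, axisPoint_re]) (by rw [him, axisPoint_im])

/-- The rotations about `i` act transitively on the circle of radius `1`. -/
theorem exists_rotation {w : ℍ} (hw : dist (axisPoint 0) w = 1) :
    ∃ R : SL(2, ℝ), R • axisPoint 0 = axisPoint 0 ∧ R • axisPoint 1 = w := by
  have e0 := circle_equation (w := w) (s := 1) (t := 0) (by simpa using hw)
  rw [Real.exp_zero] at e0
  set E := Real.exp 1 with hE
  have hEp : 0 < E := Real.exp_pos 1
  have hsn : E * Real.exp (-1) = 1 := by rw [hE, ← Real.exp_add]; simp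
  -- the two real equations for a rotation `(α β; -β α)` taking `i e` to `w` are proportional,
  -- because `w` lies on the circle
  have hc : E * w.re ^ 2 = (1 - w.im * E) * (w.im - E) := by
    linear_combination E * e0 + w.im * hsn
  obtain ⟨α, β, hne, h1, h2⟩ : ∃ α β : ℝ, α ^ 2 + β ^ 2 ≠ 0 ∧ w.re * α = β * (1 - w.im * E) ∧
      α * (w.im - E) = w.re * β * E := by
    by_cases hx : (1 - w.im * E) ^ 2 + w.re ^ 2 = 0
    · have h1 : 1 - w.im * E = 0 := by nlinarith [sq_nonneg (1 - w.im * E), sq_nonneg w.re]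
      have h2 : w.re = 0 := by nlinarith [sq_nonneg (1 - w.im * E), sq_nonneg w.re]
      exact ⟨0, 1, by norm_num, by rw [h1]; ring, by rw [h2]; ring⟩
    · exact ⟨1 - w.im * E, w.re, hx, by ring, by linear_combination -hc⟩
  set ν := √(α ^ 2 + β ^ 2) with hν
  have hν2 : ν ^ 2 = α ^ 2 + β ^ 2 := Real.sq_sqrt (by positivity)
  have hν0 : ν ≠ 0 := by
    intro h; rw [h] at hν2; apply hne; rw [← hν2]; norm_num
  let R : SL(2, ℝ) := ⟨!![α / ν, β / ν; -(β / ν), α / ν], by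
    rw [Matrix.det_fin_two_of]
    field_simp
    linear_combination -hν2⟩
  have r00 : R 0 0 = α / ν := rfl
  have r01 : R 0 1 = β / ν := rfl
  have r10 : R 1 0 = -(β / ν) := rfl
  have r11 : R 1 1 = α / ν := rfl
  have hν0' : (ν : ℂ) ≠ 0 := by exact_mod_cast hν0
  refine ⟨R, ?_, ?_⟩
  · apply UpperHalfPlane.ext
    have hd := autFactor_ne_zero R (axisPoint 0)
    rw [coe_sl2_smul]
    rw [autFactor] at hd
    rw [div_eq_iff hd, r00, r01, r10, r11, coe_axisPoint]
    push_cast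
    rw [Complex.exp_zero]
    linear_combination (β / ν : ℂ) * I_sq
  · apply UpperHalfPlane.ext
    have hd := autFactor_ne_zero R (axisPoint 1)
    rw [coe_sl2_smul]
    rw [autFactor] at hd
    rw [div_eq_iff hd, r00, r01, r10, r11, coe_axisPoint, ← hE]
    push_cast
    have hw' : (w : ℂ) = w.re + w.im * I := (Complex.re_add_im (w : ℂ)).symm
    rw [hw']
    have h1' : (w.re * α : ℂ) = β * (1 - w.im * E) := by exact_mod_cast h1
    have h2' : (α * (w.im - E) : ℂ) = w.re * β * E := by exact_mod_cast h2
    field_simp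
    linear_combination (-1 : ℂ) * h1' - I * h2' + (w.im * β * E : ℂ) * I_sq

/-- Every geodesic line of `ℍ` is the image of the imaginary half axis under `SL(2, ℝ)`. -/
theorem exists_sl2_smul_axisPoint {c : ℝ → ℍ} (hc : Isometry c) :
    ∃ h : SL(2, ℝ), ∀ s, c s = h • axisPoint s := by
  have hI : axisPoint 0 = UpperHalfPlane.I := by
    apply UpperHalfPlane.ext; rw [coe_axisPoint]; simp
  set h₁ := (c 0).toSL2R with hh₁
  have h10 : h₁ • axisPoint 0 = c 0 := by rw [hI, UpperHalfPlane.toSL2R_smul_I]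
  obtain ⟨R, hR0, hR1⟩ := exists_rotation (w := h₁⁻¹ • c 1) (by
    rw [← dist_smul h₁, h10, smul_inv_smul, hc.dist_eq]; simp)
  refine ⟨h₁ * R, fun s => ?_⟩
  have e0 : (h₁ * R) • axisPoint 0 = c 0 := by rw [mul_smul, hR0, h10]
  have e1 : (h₁ * R) • axisPoint 1 = c 1 := by rw [mul_smul, hR1, smul_inv_smul]
  rw [← inv_smul_eq_iff]
  apply eq_axisPoint
  · rw [← dist_smul (h₁ * R), e0, smul_inv_smul, hc.dist_eq, Real.dist_eq, zero_sub, abs_neg]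
  · rw [← dist_smul (h₁ * R), e1, smul_inv_smul, hc.dist_eq, Real.dist_eq, abs_sub_comm]

/-- The velocity `v` of a geodesic `c` has norm `Im c`, and there is a square root `a` of
`1 / (r v)` which satisfies the geodesic equation in the form `a' = i v a / (2 Im c)`. -/
theorem exists_frame_scale {c : ℝ → ℍ} (hc : Isometry c) {r : ℝ} (hr : 0 < r) :
    ∃ a v : ℝ → ℂ, Continuous v ∧ (∀ s, HasDerivAt (fun u => (c u : ℂ)) (v s) s) ∧
      (∀ s, ‖v s‖ = (c s).im) ∧ (∀ s, a s ^ 2 * (r * v s) = 1) ∧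
      ∀ s, HasDerivAt a (I * v s / (2 * ((c s).im : ℂ)) * a s) s := by
  obtain ⟨h, hh⟩ := exists_sl2_smul_axisPoint hc
  set D : ℝ → ℂ := fun s => autFactor h (axisPoint s) with hD
  have hDe : ∀ s, D s = h 1 0 * (I * (Real.exp s : ℂ)) + h 1 1 := fun s => rfl
  have hD0 : ∀ s, D s ≠ 0 := fun s => autFactor_ne_zero h _
  have hdet : (h 0 0 * h 1 1 - h 0 1 * h 1 0 : ℂ) = 1 := by exact_mod_cast sl2_det_eq h
  have hE : ∀ s : ℝ, HasDerivAt (fun u : ℝ => I * (Real.exp u : ℂ)) (I * (Real.exp s : ℂ)) s :=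
    fun s => ((Real.hasDerivAt_exp s).ofReal_comp).const_mul I
  have hDd : ∀ s, HasDerivAt D (h 1 0 * (I * (Real.exp s : ℂ))) s := fun s =>
    ((hE s).const_mul (h 1 0 : ℂ)).add_const _
  have hce : ∀ s, (c s : ℂ) = (h 0 0 * (I * (Real.exp s : ℂ)) + h 0 1) / D s := by
    intro s; rw [hh, coe_sl2_smul]; rfl
  have hDconj : ∀ s, (starRingEnd ℂ) (D s) = -(h 1 0 * (I * (Real.exp s : ℂ))) + h 1 1 := by
    intro s; rw [hDe]; simp [-ofReal_exp]
  have him : ∀ s, ((c s).im : ℂ) * (D s * (starRingEnd ℂ) (D s)) = Real.exp s := by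
    intro s
    have h1 : (c s).im = (c s : ℂ).im := rfl
    have h2 := hDconj s
    have h3 : (starRingEnd ℂ) (D s) ≠ 0 := by simpa using hD0 s
    have h4 : (starRingEnd ℂ) (h 0 0 * (I * (Real.exp s : ℂ)) + h 0 1)
        = -(h 0 0 * (I * (Real.exp s : ℂ))) + h 0 1 := by
      simp [-ofReal_exp]
    have h5 := hD0 s
    rw [h1, Complex.im_eq_sub_conj, hce, map_div₀, h4]
    field_simp
    rw [h2, hDe]
    linear_combination (2 * I * (Real.exp s : ℂ)) * hdet
  -- for the imaginary axis `v = i e ^ s`, so that `a = ζ e ^ (-s / 2)`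
  obtain ⟨ζ, hζ⟩ : ∃ ζ : ℂ, ζ ^ 2 * (r * I) = 1 := by
    obtain ⟨ζ, hζ⟩ := IsAlgClosed.exists_pow_nat_eq ((r * I : ℂ)⁻¹) two_pos
    have : (r * I : ℂ) ≠ 0 := mul_ne_zero (by exact_mod_cast hr.ne') I_ne_zero
    exact ⟨ζ, by rw [hζ, inv_mul_cancel₀ this]⟩
  have hexp : ∀ s : ℝ, ((Real.exp (-s / 2) : ℝ) : ℂ) ^ 2 * (Real.exp s : ℂ) = 1 := by
    intro s
    rw [← ofReal_pow, ← ofReal_mul, ← Real.exp_nat_mul, ← Real.exp_add]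
    norm_num
    ring_nf
    simp
  refine ⟨fun s => D s * (Real.exp (-s / 2) : ℝ) * ζ, fun s => I * (Real.exp s : ℂ) / D s ^ 2,
    ?_, ?_, ?_, ?_, ?_⟩
  · have hDc : Continuous D := continuous_iff_continuousAt.2 fun s => (hDd s).continuousAt
    exact Continuous.div (by fun_prop) (hDc.pow 2) fun s => pow_ne_zero 2 (hD0 s)
  · intro s
    have h2 : (fun u => (c u : ℂ)) = fun u => ((h • axisPoint u : ℍ) : ℂ) :=
      funext fun u => by rw [hh]
    rw [h2]
    refine (hasDerivAt_sl2_smul h (hE s)).congr_deriv ?_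
    rw [mobiusDeriv, inv_mul_eq_div]
  · intro s
    have h1 := congrArg norm (him s)
    rw [norm_mul, norm_mul, RCLike.norm_conj, norm_real, norm_real,
      Real.norm_of_nonneg (c s).im_pos.le, Real.norm_of_nonneg (Real.exp_pos s).le] at h1
    rw [norm_div, norm_mul, norm_I, norm_pow, norm_real,
      Real.norm_of_nonneg (Real.exp_pos s).le, ← h1]
    have := norm_ne_zero_iff.2 (hD0 s)
    field_simp
  · intro s
    have e : (D s * (Real.exp (-s / 2) : ℝ) * ζ) ^ 2 * (r * (I * (Real.exp s : ℂ) / D s ^ 2))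
        = (ζ ^ 2 * (r * I)) * (((Real.exp (-s / 2) : ℝ) : ℂ) ^ 2 * (Real.exp s : ℂ)) := by
      have := hD0 s
      generalize ((Real.exp (-s / 2) : ℝ) : ℂ) = x
      field_simp
    rw [e, hexp, hζ, mul_one]
  · intro s
    have h1 : HasDerivAt (fun u : ℝ => ((Real.exp (-u / 2) : ℝ) : ℂ))
        ((Real.exp (-s / 2) * (-1 / 2) : ℝ) : ℂ) s :=
      (((hasDerivAt_id s).neg.div_const 2).exp).ofReal_comp
    have hi : ((c s).im : ℂ) ≠ 0 := by exact_mod_cast (c s).im_pos.ne'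
    have h3 : I * (I * (Real.exp s : ℂ) / D s ^ 2) / (2 * ((c s).im : ℂ)) * D s
        = -(starRingEnd ℂ) (D s) / 2 := by
      rw [← him]
      have := hD0 s
      field_simp
      rw [I_sq]; ring
    refine (((hDd s).mul h1).mul_const ζ).congr_deriv ?_
    have h4 : I * (I * (Real.exp s : ℂ) / D s ^ 2) / (2 * ((c s).im : ℂ))
          * (D s * (Real.exp (-s / 2) : ℝ) * ζ)
        = -(starRingEnd ℂ) (D s) / 2 * (Real.exp (-s / 2) : ℝ) * ζ := by
      rw [← h3]; ring
    refine Eq.trans ?_ h4.symm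
    rw [hDconj, hDe]
    push_cast
    ring

end HitchinVariation

/-! ### The Fuchsian connection and the Hitchin deformation as matrices -/

namespace HitchinVariation
open Complex

/-- Entrywise differentiability of a curve of matrices. -/
def HasEntryDerivAt {n : ℕ} (M : ℝ → Matrix (Fin n) (Fin n) ℂ) (M' : Matrix (Fin n) (Fin n) ℂ)
    (s : ℝ) : Prop :=
  ∀ i j, HasDerivAt (fun u => M u i j) (M' i j) s

theorem HasEntryDerivAt.mul {n : ℕ} {M N : ℝ → Matrix (Fin n) (Fin n) ℂ}
    {M' N' : Matrix (Fin n) (Fin n) ℂ} {s : ℝ} (hM : HasEntryDerivAt M M' s)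
    (hN : HasEntryDerivAt N N' s) :
    HasEntryDerivAt (fun u => M u * N u) (M' * N s + M s * N') s := by
  intro i j
  simp only [Matrix.mul_apply, Matrix.add_apply, ← Finset.sum_add_distrib]
  exact HasDerivAt.fun_sum fun k _ => (hM i k).mul (hN k j)

theorem hasEntryDerivAt_const {n : ℕ} (M : Matrix (Fin n) (Fin n) ℂ) (s : ℝ) :
    HasEntryDerivAt (fun _ => M) 0 s := fun i j => hasDerivAt_const s (M i j)

theorem hasEntryDerivAt_diagonal {n : ℕ} {f : ℝ → Fin n → ℂ} {f' : Fin n → ℂ} {s : ℝ}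
    (hf : ∀ i, HasDerivAt (fun u => f u i) (f' i) s) :
    HasEntryDerivAt (fun u => Matrix.diagonal (f u)) (Matrix.diagonal f') s := by
  intro i j
  by_cases hij : i = j
  · subst hij; simpa using hf i
  · simpa [Matrix.diagonal_apply_ne _ hij] using hasDerivAt_const s (0 : ℂ)

theorem HasEntryDerivAt.congr_deriv {n : ℕ} {M : ℝ → Matrix (Fin n) (Fin n) ℂ}
    {M' N' : Matrix (Fin n) (Fin n) ℂ} {s : ℝ} (hM : HasEntryDerivAt M M' s) (h : M' = N') :
    HasEntryDerivAt M N' s := h ▸ hM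

/-- The grading element `diag (b ^ (2 p - n - 1))`. -/
noncomputable def gradDiag (n : ℕ) (b : ℂ) : Matrix (Fin n) (Fin n) ℂ :=
  Matrix.diagonal fun i => b ^ weight n i

/-- The matrix of `√2 Y`. -/
noncomputable def raiseC (n : ℕ) : Matrix (Fin n) (Fin n) ℂ := ofRealHom.mapMatrix (raise n)

theorem raiseC_apply (n : ℕ) (i j : Fin n) : raiseC n i j = (raise n i j : ℂ) := rfl

theorem gradDiag_mul_gradDiag (n : ℕ) (b b' : ℂ) :
    gradDiag n b * gradDiag n b' = gradDiag n (b * b') := by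
  simp [gradDiag, Matrix.diagonal_mul_diagonal, mul_zpow]

theorem gradDiag_one (n : ℕ) : gradDiag n 1 = 1 := by
  simp [gradDiag]

theorem gradDiag_inv_mul {n : ℕ} {b : ℂ} (hb : b ≠ 0) : gradDiag n b⁻¹ * gradDiag n b = 1 := by
  rw [gradDiag_mul_gradDiag, inv_mul_cancel₀ hb, gradDiag_one]

theorem inv_gradDiag {n : ℕ} {b : ℂ} (hb : b ≠ 0) : (gradDiag n b)⁻¹ = gradDiag n b⁻¹ :=
  Matrix.inv_eq_left_inv (gradDiag_inv_mul hb)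

/-- `√2 Y` has degree `-2` for the grading. -/
theorem gradDiag_mul_raiseC {n : ℕ} {b : ℂ} (hb : b ≠ 0) :
    gradDiag n b * raiseC n = (b ^ 2)⁻¹ • (raiseC n * gradDiag n b) := by
  ext i j
  rw [Matrix.smul_apply, gradDiag, Matrix.diagonal_mul, Matrix.mul_diagonal, raiseC_apply, raise]
  split_ifs with h
  · have : weight n j = weight n i + 2 := by
      have : (j.val : ℤ) = i.val + 1 := by exact_mod_cast h
      simp only [weight]; omega
    rw [this, zpow_add₀ hb, smul_eq_mul]
    norm_cast
    field_simp
  · simp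

theorem gradDiag_mul_raiseC_pow {n : ℕ} {b : ℂ} (hb : b ≠ 0) (m : ℕ) :
    gradDiag n b * raiseC n ^ m = ((b ^ 2)⁻¹) ^ m • (raiseC n ^ m * gradDiag n b) := by
  induction m with
  | zero => simp
  | succ m ih =>
    rw [pow_succ, ← mul_assoc, ih, smul_mul_assoc, mul_assoc, gradDiag_mul_raiseC hb,
      mul_smul_comm, smul_smul, ← mul_assoc, ← pow_succ]

theorem gradDiag_mul_transpose_raiseC_pow {n : ℕ} {b : ℂ} (hb : b ≠ 0) (m : ℕ) :
    gradDiag n b * (raiseC n).transpose ^ m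
      = (b ^ 2) ^ m • ((raiseC n).transpose ^ m * gradDiag n b) := by
  have h := congrArg Matrix.transpose (gradDiag_mul_raiseC_pow (n := n) hb m)
  rw [Matrix.transpose_smul, Matrix.transpose_mul, Matrix.transpose_mul, Matrix.transpose_pow] at h
  have ht : (gradDiag n b).transpose = gradDiag n b := Matrix.diagonal_transpose _
  rw [ht] at h
  rw [h, smul_smul, ← mul_pow, mul_inv_cancel₀ (pow_ne_zero 2 hb), one_pow, one_smul]

theorem gradDiag_conj_raiseC_pow {n : ℕ} {b : ℂ} (hb : b ≠ 0) (m : ℕ) :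
    gradDiag n b⁻¹ * raiseC n ^ m * gradDiag n b = (b ^ 2) ^ m • raiseC n ^ m := by
  rw [gradDiag_mul_raiseC_pow (inv_ne_zero hb), smul_mul_assoc, mul_assoc, gradDiag_inv_mul hb,
    mul_one, inv_pow b 2, inv_inv]

theorem gradDiag_conj_transpose_raiseC_pow {n : ℕ} {b : ℂ} (hb : b ≠ 0) (m : ℕ) :
    gradDiag n b⁻¹ * (raiseC n).transpose ^ m * gradDiag n b
      = ((b ^ 2)⁻¹) ^ m • (raiseC n).transpose ^ m := by
  rw [gradDiag_mul_transpose_raiseC_pow (inv_ne_zero hb), smul_mul_assoc, mul_assoc,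
    gradDiag_inv_mul hb, mul_one, inv_pow b 2]

theorem matY_eq (n : ℕ) : matY n = ((√2 : ℝ) : ℂ)⁻¹ • raiseC n := by
  ext i j
  rw [Matrix.smul_apply, raiseC_apply, matY, raise]
  split_ifs with h
  · rw [Real.sqrt_div' _ (by norm_num)]
    push_cast
    rw [smul_eq_mul, inv_mul_eq_div]
  · simp

theorem matE_eq (n k : ℕ) : matE n k = (raiseC n).transpose ^ k := by
  rw [matE]
  congr 1
  ext i j
  have h2 : ((√2 : ℝ) : ℂ) ≠ 0 := by
    exact_mod_cast (Real.sqrt_pos.2 (by norm_num : (0 : ℝ) < 2)).ne'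
  rw [Matrix.neg_apply, Matrix.smul_apply, Matrix.transpose_apply, raiseC_apply, matX, raise]
  split_ifs with h
  · rw [Real.sqrt_div' _ (by norm_num)]
    push_cast
    rw [smul_eq_mul]
    field_simp
  · simp

theorem conjTranspose_raiseC (n : ℕ) : (raiseC n).conjTranspose = (raiseC n).transpose := by
  ext i j
  rw [Matrix.conjTranspose_apply, Matrix.transpose_apply, raiseC_apply]
  exact conj_ofReal _

/-- The involution `σ` reverses products up to sign and maps `Y` to `-Y`. -/
theorem sigmaInv_raiseC_pow (n m : ℕ) : sigmaInv (raiseC n ^ m) = -raiseC n ^ m := by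
  have h1 : ∀ M N : Matrix (Fin n) (Fin n) ℂ, sigmaInv (M * N) = -(sigmaInv N * sigmaInv M) := by
    intro M N
    ext i j
    simp only [sigmaInv, Matrix.mul_apply, Matrix.neg_apply, neg_mul_neg]
    rw [← Equiv.sum_comp Fin.revPerm]
    simp [mul_comm]
  have h2 : sigmaInv (raiseC n) = -raiseC n := by
    ext i j
    rw [sigmaInv, Matrix.neg_apply, raiseC_apply, raiseC_apply, raise, raise]
    have hi := i.2
    have hj := j.2
    by_cases h : j.val = i.val + 1
    · rw [if_pos h, if_pos (by rw [Fin.val_rev, Fin.val_rev]; omega)]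
      congr 3
      have e : ((j.rev.val : ℕ) : ℝ) = n - (j.val + 1) := by
        rw [Fin.val_rev, Nat.cast_sub (by omega)]; push_cast; ring
      rw [e, h]
      push_cast
      ring
    · rw [if_neg h, if_neg (by rw [Fin.val_rev, Fin.val_rev]; omega)]
  induction m with
  | zero =>
    ext i j
    simp [sigmaInv, Matrix.one_apply, eq_comm]
  | succ m ih =>
    rw [pow_succ', h1, ih, h2, neg_mul_neg, ← pow_succ, ← pow_succ']

theorem sigmaInv_smul {n : ℕ} (a : ℂ) (M : Matrix (Fin n) (Fin n) ℂ) :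
    sigmaInv (a • M) = a • sigmaInv M := by
  ext i j; simp [sigmaInv]

theorem hermMetric_eq (n : ℕ) (r : ℝ) (w : ℂ) :
    hermMetric n r w = gradDiag n ((r * w.im : ℝ) : ℂ) := by
  rw [hermMetric, gradDiag]
  congr 1
  ext i
  push_cast
  rfl

/-- The adjoint for the Hermitian metric is a conjugate of the standard one by the grading. -/
theorem cartanInv_eq {n : ℕ} {r : ℝ} (hr : 0 < r) (z : ℍ) (M : Matrix (Fin n) (Fin n) ℂ) :
    cartanInv r z M = -(gradDiag n ((r * z.im : ℝ) : ℂ)⁻¹ * M.conjTranspose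
      * gradDiag n ((r * z.im : ℝ) : ℂ)) := by
  have h : ((r * z.im : ℝ) : ℂ) ≠ 0 := by exact_mod_cast (mul_pos hr z.im_pos).ne'
  rw [cartanInv, hermMetric_eq, UpperHalfPlane.coe_im, inv_gradDiag h]

/-- `∂H = H diag (-i (2 p - n - 1) / (2 y))`. -/
theorem wirtinger_hermMetric {n : ℕ} {r : ℝ} (hr : 0 < r) (z : ℍ) (i j : Fin n) :
    wirtinger (fun w => hermMetric n r w i j) z
      = (gradDiag n ((r * z.im : ℝ) : ℂ) *
          Matrix.diagonal fun i => -I * weight n i / (2 * (z.im : ℂ))) i j := by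
  have hy := z.im_pos
  rw [Matrix.mul_diagonal]
  by_cases hij : i = j
  · subst hij
    have h1 : HasFDerivAt (fun w : ℂ => r * w.im) (r • imCLM) (z : ℂ) :=
      imCLM.hasFDerivAt.const_mul r
    have h2 := (hasDerivAt_zpow (weight n i) (r * (z : ℂ).im)
      (Or.inl (mul_pos hr hy).ne')).comp_hasFDerivAt (z : ℂ) h1
    have h3 := ofRealCLM.hasFDerivAt.comp (z : ℂ) h2
    have h4 : (fun w => hermMetric n r w i i) =
        ofRealCLM ∘ ((fun x : ℝ => x ^ weight n i) ∘ fun w : ℂ => r * w.im) := by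
      ext w; simp [hermMetric]
    rw [wirtinger, h4, h3.fderiv]
    have hy' : (z.im : ℂ) ≠ 0 := by exact_mod_cast hy.ne'
    have hr' : (r : ℂ) ≠ 0 := by exact_mod_cast hr.ne'
    simp [gradDiag]
    rw [zpow_sub_one₀ (mul_ne_zero hr' hy')]
    field_simp
  · have h4 : (fun w => hermMetric n r w i j) = fun _ => 0 := by
      ext w; simp [hermMetric, Matrix.diagonal_apply_ne _ hij]
    rw [wirtinger, h4]
    simp [gradDiag, Matrix.diagonal_apply_ne _ hij]

/-- The Fuchsian connection form in terms of the principal `sl(2)`. -/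
theorem fuchsianForm_eq {n : ℕ} {r : ℝ} (hr : 0 < r) (z : ℍ) (v : ℂ) :
    fuchsianForm n r z v = Matrix.diagonal (fun i => -(I * v / (2 * (z.im : ℂ)) * weight n i))
      + (r * v / 2) • raiseC n
      + ((starRingEnd ℂ) v / (2 * r * (z.im : ℂ) ^ 2)) • (raiseC n).transpose := by
  have hy' : (z.im : ℂ) ≠ 0 := by exact_mod_cast z.im_pos.ne'
  have hr' : (r : ℂ) ≠ 0 := by exact_mod_cast hr.ne'
  have hb : ((r * z.im : ℝ) : ℂ) ≠ 0 := by push_cast; exact mul_ne_zero hr' hy'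
  have h2 : ((√2 : ℝ) : ℂ) ^ 2 = 2 := by exact_mod_cast Real.sq_sqrt (by norm_num : (0 : ℝ) ≤ 2)
  have h20 : ((√2 : ℝ) : ℂ) ≠ 0 := by
    exact_mod_cast (Real.sqrt_pos.2 (by norm_num : (0 : ℝ) < 2)).ne'
  have hΦ : higgsField n r z v = (r * v / 2) • raiseC n := by
    have : higgsField n r z v = (((r / √2 : ℝ) : ℂ) * v) • matY n := rfl
    rw [this, matY_eq, smul_smul]
    congr 1
    push_cast
    rw [← h2]
    field_simp
  have hρ : cartanInv r z (higgsField n r z v)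
      = -(((starRingEnd ℂ) v / (2 * r * (z.im : ℂ) ^ 2)) • (raiseC n).transpose) := by
    rw [hΦ, cartanInv_eq hr, Matrix.conjTranspose_smul, conjTranspose_raiseC, mul_smul_comm,
      smul_mul_assoc]
    have := gradDiag_conj_transpose_raiseC_pow (n := n) hb 1
    rw [pow_one, pow_one] at this
    rw [this, smul_smul]
    congr 2
    simp
    field_simp
  have hc : chernForm n r z v
      = Matrix.diagonal (fun i => -(I * v / (2 * (z.im : ℂ)) * weight n i)) := by
    have h3 : (Matrix.of fun i j => wirtinger (fun w => hermMetric n r w i j) z)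
        = gradDiag n ((r * z.im : ℝ) : ℂ) *
          Matrix.diagonal fun i => -I * weight n i / (2 * (z.im : ℂ)) := by
      ext i j; exact wirtinger_hermMetric hr z i j
    rw [chernForm, h3, hermMetric_eq, UpperHalfPlane.coe_im, inv_gradDiag hb, ← mul_assoc,
      gradDiag_inv_mul hb, one_mul, ← Matrix.diagonal_smul]
    congr 1
    ext i
    simp only [Pi.smul_apply, smul_eq_mul]
    ring
  rw [fuchsianForm, hc, hρ, hΦ, sub_neg_eq_add]

/-- The standard Hitchin deformation in terms of the principal `sl(2)`. -/
theorem hitchinDeformation_eq {n : ℕ} {r : ℝ} (hr : 0 < r) {Γ : Subgroup SL(2, ℝ)} {k : ℕ}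
    (q : HolDifferential Γ k) (z : ℍ) (v : ℂ) :
    hitchinDeformation n r q z v = (q.toFun z * v) • (raiseC n).transpose ^ (k - 1)
      + ((starRingEnd ℂ) (q.toFun z * v) * (((r * z.im : ℝ) : ℂ) ^ 2) ^ (k - 1))
          • raiseC n ^ (k - 1) := by
  have hb : ((r * z.im : ℝ) : ℂ) ≠ 0 := by exact_mod_cast (mul_pos hr z.im_pos).ne'
  have h1 : operDeformation n q z v = (q.toFun z * v) • (raiseC n).transpose ^ (k - 1) := by
    rw [← matE_eq]; rfl
  have h2 : ((raiseC n).transpose ^ (k - 1)).conjTranspose = raiseC n ^ (k - 1) := by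
    rw [← conjTranspose_raiseC, Matrix.conjTranspose_pow, Matrix.conjTranspose_conjTranspose]
  rw [hitchinDeformation, splitInv, h1, cartanInv_eq hr, Matrix.conjTranspose_smul, h2,
    mul_smul_comm, smul_mul_assoc, gradDiag_conj_raiseC_pow hb, smul_smul, ← neg_smul,
    sigmaInv_smul, sigmaInv_raiseC_pow, neg_smul_neg]
  rfl

end HitchinVariation

/-! ### The parallel frame along a closed geodesic -/

namespace HitchinVariation
open Complex

/-- The matrix of eigenvectors `eigenMatrix n`, with complex entries. -/
noncomputable def eigenMatrixC (n : ℕ) : Matrix (Fin n) (Fin n) ℂ :=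
  ofRealHom.mapMatrix (eigenMatrix n)

/-- The inverse of `eigenMatrixC n`, see `eigenMatrixInvC_mul`. -/
noncomputable def eigenMatrixInvC (n : ℕ) : Matrix (Fin n) (Fin n) ℂ :=
  ofRealHom.mapMatrix (eigenMatrixInv n)

theorem eigenMatrixInvC_mul (n : ℕ) : eigenMatrixInvC n * eigenMatrixC n = 1 := by
  rw [eigenMatrixInvC, eigenMatrixC, ← map_mul, eigenMatrixInv_mul, map_one]

theorem transpose_raiseC (n : ℕ) :
    (raiseC n).transpose = ofRealHom.mapMatrix (raise n).transpose := rfl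

theorem raiseC_add_transpose_mul_eigenMatrixC (n : ℕ) :
    (raiseC n + (raiseC n).transpose) * eigenMatrixC n
      = eigenMatrixC n * Matrix.diagonal fun a => (weight n a : ℂ) := by
  have h : (Matrix.diagonal fun a => (weight n a : ℂ))
      = ofRealHom.mapMatrix (Matrix.diagonal fun a => (weight n a : ℝ)) := by
    rw [RingHom.mapMatrix_apply, Matrix.diagonal_map (map_zero _)]
    simp
  rw [transpose_raiseC, raiseC, eigenMatrixC, h, ← map_add, ← map_mul, ← map_mul,
    raise_add_transpose_mul_eigenMatrix]

theorem raiseC_pow_diag {n : ℕ} (m : ℕ) (a : Fin n) :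
    (eigenMatrixInvC n * raiseC n ^ m * eigenMatrixC n) a a = (diagCoeff n m a : ℂ) := by
  rw [← raise_pow_diag_eq, eigenMatrixInvC, eigenMatrixC, raiseC, ← map_pow, ← map_mul, ← map_mul]
  rfl

theorem transpose_raiseC_pow_diag {n : ℕ} (m : ℕ) (a : Fin n) :
    (eigenMatrixInvC n * (raiseC n).transpose ^ m * eigenMatrixC n) a a
      = (diagCoeff n m a : ℂ) := by
  rw [← raise_pow_diag_eq, ← eigenMatrixInv_mul_transpose_diag, Matrix.transpose_pow,
    transpose_raiseC, eigenMatrixInvC, eigenMatrixC, ← map_pow, ← map_mul, ← map_mul]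
  rfl

theorem hasEntryDerivAt_gradDiag {n : ℕ} {a : ℝ → ℂ} {x : ℂ} {s : ℝ} (ha0 : a s ≠ 0)
    (ha : HasDerivAt a (x * a s) s) :
    HasEntryDerivAt (fun u => gradDiag n (a u))
      ((Matrix.diagonal fun i => x * weight n i) * gradDiag n (a s)) s := by
  rw [gradDiag, Matrix.diagonal_mul_diagonal]
  refine hasEntryDerivAt_diagonal fun i => ?_
  refine ((hasDerivAt_zpow (weight n i) (a s) (Or.inl ha0)).comp s ha).congr_deriv ?_
  rw [zpow_sub_one₀ ha0]
  field_simp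

/-- The transport of the Fuchsian connection over a time `s` in the eigenbasis:
`diag (exp (-s (2 p - n - 1) / 2))`. -/
noncomputable def transportDiag (n : ℕ) (s : ℝ) : Matrix (Fin n) (Fin n) ℂ :=
  Matrix.diagonal fun i => ((Real.exp (-s * (weight n i / 2)) : ℝ) : ℂ)

theorem hasEntryDerivAt_transportDiag (n : ℕ) (s : ℝ) :
    HasEntryDerivAt (transportDiag n)
      (-((Matrix.diagonal fun i => (weight n i : ℂ) / 2) * transportDiag n s)) s := by
  rw [transportDiag, Matrix.diagonal_mul_diagonal, Matrix.diagonal_neg]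
  refine hasEntryDerivAt_diagonal fun i => ?_
  refine ((((hasDerivAt_id s).neg.mul_const ((weight n i : ℝ) / 2)).exp).ofReal_comp).congr_deriv ?_
  simp [-ofReal_exp]
  ring

theorem transportDiag_mul (n : ℕ) (s t : ℝ) :
    transportDiag n s * transportDiag n t = transportDiag n (s + t) := by
  rw [transportDiag, transportDiag, transportDiag, Matrix.diagonal_mul_diagonal]
  congr 1
  ext i
  rw [← ofReal_mul, ← Real.exp_add]
  congr 2
  ring

theorem transportDiag_zero (n : ℕ) : transportDiag n 0 = 1 := by
  simp [transportDiag]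

/-- The parallel frame of the Fuchsian connection along a geodesic; `a` is a square root of the
inverse of `r` times the velocity. -/
noncomputable def parallelFrame (n : ℕ) (a : ℝ → ℂ) (s : ℝ) : Matrix (Fin n) (Fin n) ℂ :=
  gradDiag n (a s) * eigenMatrixC n * transportDiag n s

/-- The inverse of the parallel frame. -/
noncomputable def parallelFrameInv (n : ℕ) (a : ℝ → ℂ) (s : ℝ) : Matrix (Fin n) (Fin n) ℂ :=
  transportDiag n (-s) * eigenMatrixInvC n * gradDiag n (a s)⁻¹

theorem parallelFrameInv_mul {n : ℕ} {a : ℝ → ℂ} {s : ℝ} (ha : a s ≠ 0) :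
    parallelFrameInv n a s * parallelFrame n a s = 1 := by
  have h1 := gradDiag_inv_mul (n := n) ha
  have h2 := eigenMatrixInvC_mul n
  have h3 : transportDiag n (-s) * transportDiag n s = 1 := by
    rw [transportDiag_mul, neg_add_cancel, transportDiag_zero]
  calc parallelFrameInv n a s * parallelFrame n a s
      = transportDiag n (-s) * (eigenMatrixInvC n * (gradDiag n (a s)⁻¹ * gradDiag n (a s))
          * eigenMatrixC n) * transportDiag n s := by
        simp only [parallelFrameInv, parallelFrame, mul_assoc]
    _ = 1 := by rw [h1, mul_one, h2, mul_one, h3]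

/-- The derivative of the inverse of a curve of matrices. -/
theorem HasEntryDerivAt.of_inv_mul {n : ℕ} {M N : ℝ → Matrix (Fin n) (Fin n) ℂ}
    {M' N' : Matrix (Fin n) (Fin n) ℂ} {s : ℝ} (hN : HasEntryDerivAt N N' s)
    (hM : HasEntryDerivAt M M' s) (h : ∀ u, N u * M u = 1) :
    HasEntryDerivAt N (-(N s * M' * N s)) s := by
  refine hN.congr_deriv ?_
  have h1 := hN.mul hM
  have h2 : (fun u => N u * M u) = fun _ => 1 := funext h
  rw [h2] at h1
  have h3 : N' * M s + N s * M' = 0 := by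
    ext i j
    exact (h1 i j).unique (hasEntryDerivAt_const (1 : Matrix (Fin n) (Fin n) ℂ) s i j)
  have h4 : M s * N s = 1 := mul_eq_one_comm.1 (h s)
  rw [eq_neg_of_add_eq_zero_right h3, neg_mul, neg_neg, mul_assoc, h4, mul_one]

theorem inv_sq_eq_of_sq_mul {a r v : ℂ} (h : a ^ 2 * (r * v) = 1) : (a ^ 2)⁻¹ = r * v :=
  inv_eq_of_mul_eq_one_right h

/-- `a ^ 2 = 1 / (r v)`, with the denominator made real by `|v| = y`. -/
theorem sq_eq_conj_div {a v : ℂ} {r y : ℝ} (hr : 0 < r) (hy : 0 < y) (hv : ‖v‖ = y)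
    (h : a ^ 2 * (r * v) = 1) : a ^ 2 = (starRingEnd ℂ) v / (r * (y : ℂ) ^ 2) := by
  have h1 : v * (starRingEnd ℂ) v = (y : ℂ) ^ 2 := by
    rw [mul_conj, normSq_eq_norm_sq, hv]; push_cast; rfl
  have hr' : (r : ℂ) ≠ 0 := by exact_mod_cast hr.ne'
  have hy' : (y : ℂ) ≠ 0 := by exact_mod_cast hy.ne'
  have hv0 : v ≠ 0 := by rintro rfl; simp at h
  rw [← h1, eq_div_iff (mul_ne_zero hr' (by rw [h1]; exact pow_ne_zero 2 hy'))]
  linear_combination (starRingEnd ℂ) v * h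

/-- `parallelFrame` is parallel for the Fuchsian connection. -/
theorem hasEntryDerivAt_parallelFrame {n : ℕ} {r : ℝ} (hr : 0 < r) {a : ℝ → ℂ} {z : ℍ} {v : ℂ}
    {s : ℝ} (hv : ‖v‖ = z.im) (ha : a s ^ 2 * (r * v) = 1)
    (ha' : HasDerivAt a (I * v / (2 * (z.im : ℂ)) * a s) s) :
    HasEntryDerivAt (parallelFrame n a) (-(fuchsianForm n r z v * parallelFrame n a s)) s := by
  have ha0 : a s ≠ 0 := by intro h; rw [h] at ha; simp at ha
  have h1 := ((hasEntryDerivAt_gradDiag (n := n) ha0 ha').mul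
    (hasEntryDerivAt_const (eigenMatrixC n) s)).mul (hasEntryDerivAt_transportDiag n s)
  refine h1.congr_deriv ?_
  -- conjugation by `gradDiag n (a s)` takes the `Y` and `Yᵀ` parts to `(Y + Yᵀ) / √2`
  have e1 : (r * v / 2) • (raiseC n * gradDiag n (a s))
      + ((starRingEnd ℂ) v / (2 * r * (z.im : ℂ) ^ 2)) • ((raiseC n).transpose * gradDiag n (a s))
      = (2 : ℂ)⁻¹ • (gradDiag n (a s) * (raiseC n + (raiseC n).transpose)) := by
    have h2 := gradDiag_mul_raiseC (n := n) ha0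
    have h3 := gradDiag_mul_transpose_raiseC_pow (n := n) ha0 1
    rw [pow_one, pow_one] at h3
    rw [mul_add, h2, h3, smul_add, smul_smul, smul_smul, inv_sq_eq_of_sq_mul ha,
      sq_eq_conj_div hr z.im_pos hv ha]
    congr 2
    · ring
    · rw [inv_mul_eq_div, div_div]
      congr 1
      ring
  have e2 : (2 : ℂ)⁻¹ • ((raiseC n + (raiseC n).transpose) * eigenMatrixC n)
      = eigenMatrixC n * Matrix.diagonal fun i => (weight n i : ℂ) / 2 := by
    rw [raiseC_add_transpose_mul_eigenMatrixC, ← mul_smul_comm, ← Matrix.diagonal_smul]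
    congr 2
    ext i
    simp only [Pi.smul_apply, smul_eq_mul]
    ring
  have e3 : ((r * v / 2) • raiseC n + ((starRingEnd ℂ) v / (2 * r * (z.im : ℂ) ^ 2)) •
      (raiseC n).transpose) * parallelFrame n a s
      = gradDiag n (a s) * eigenMatrixC n * ((Matrix.diagonal fun i => (weight n i : ℂ) / 2)
          * transportDiag n s) := by
    rw [parallelFrame, ← mul_assoc, ← mul_assoc, add_mul, smul_mul_assoc, smul_mul_assoc, e1,
      smul_mul_assoc, mul_assoc (gradDiag n (a s)), ← mul_smul_comm, e2]
    simp only [mul_assoc]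
  rw [fuchsianForm_eq hr, add_assoc, add_mul _ _ (parallelFrame n a s), e3, mul_zero, add_zero,
    neg_add, ← Matrix.diagonal_neg, neg_mul, neg_neg, mul_neg, parallelFrame]
  simp only [mul_assoc]

theorem hasEntryDerivAt_parallelFrameInv {n : ℕ} {r : ℝ} (hr : 0 < r) {a : ℝ → ℂ} {z : ℍ} {v : ℂ}
    {s : ℝ} (ha0 : ∀ u, a u ≠ 0) (hv : ‖v‖ = z.im) (ha : a s ^ 2 * (r * v) = 1)
    (ha' : HasDerivAt a (I * v / (2 * (z.im : ℂ)) * a s) s) :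
    HasEntryDerivAt (parallelFrameInv n a) (parallelFrameInv n a s * fuchsianForm n r z v) s := by
  have hinv : HasDerivAt (fun u => (a u)⁻¹) (-(I * v / (2 * (z.im : ℂ))) * (a s)⁻¹) s := by
    refine (ha'.inv (ha0 s)).congr_deriv ?_
    have := ha0 s
    field_simp
  have hE : HasEntryDerivAt (fun u => transportDiag n (-u))
      ((Matrix.diagonal fun i => (weight n i : ℂ) / 2) * transportDiag n (-s)) s := fun i j =>
    ((hasEntryDerivAt_transportDiag n (-s) i j).scomp s (hasDerivAt_neg s)).congr_deriv (by simp)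
  have h1 := ((hE.mul (hasEntryDerivAt_const (eigenMatrixInvC n) s)).mul
    (hasEntryDerivAt_gradDiag (n := n) (inv_ne_zero (ha0 s)) hinv)).of_inv_mul
    (hasEntryDerivAt_parallelFrame hr hv ha ha') fun u => parallelFrameInv_mul (ha0 u)
  refine h1.congr_deriv ?_
  have h2 : parallelFrame n a s * parallelFrameInv n a s = 1 :=
    mul_eq_one_comm.1 (parallelFrameInv_mul (ha0 s))
  have h3 : transportDiag n (-s) * eigenMatrixInvC n * gradDiag n (a s)⁻¹
      = parallelFrameInv n a s := rfl
  rw [h3, mul_neg, neg_mul, neg_neg, mul_assoc, mul_assoc, h2, mul_one]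

theorem continuous_parallelFrame_apply {n : ℕ} {a : ℝ → ℂ} (ha : Continuous a) (ha0 : ∀ s, a s ≠ 0)
    (i j : Fin n) : Continuous fun s => parallelFrame n a s i j := by
  simp only [parallelFrame, gradDiag, transportDiag, Matrix.mul_diagonal, Matrix.diagonal_mul]
  have h : Continuous fun s => a s ^ weight n i := ha.zpow₀ _ fun s => Or.inl (ha0 s)
  fun_prop

theorem continuous_parallelFrameInv_apply {n : ℕ} {a : ℝ → ℂ} (ha : Continuous a)
    (ha0 : ∀ s, a s ≠ 0) (i j : Fin n) : Continuous fun s => parallelFrameInv n a s i j := by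
  simp only [parallelFrameInv, gradDiag, transportDiag, Matrix.mul_diagonal, Matrix.diagonal_mul]
  have h : Continuous fun s => (a s)⁻¹ ^ weight n j :=
    (ha.inv₀ ha0).zpow₀ _ fun s => Or.inl (inv_ne_zero (ha0 s))
  fun_prop

/-- The diagonal entries of the Hitchin deformation in the parallel frame. -/
theorem parallelFrame_hitchinDeformation_diag {n : ℕ} {r : ℝ} (hr : 0 < r) {Γ : Subgroup SL(2, ℝ)}
    {k : ℕ} (hk : 1 ≤ k) (q : HolDifferential Γ k) {a : ℝ → ℂ} {z : ℍ} {v : ℂ} {s : ℝ}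
    (hv : ‖v‖ = z.im) (ha : a s ^ 2 * (r * v) = 1) (p : Fin n) :
    (parallelFrameInv n a s * hitchinDeformation n r q z v * parallelFrame n a s) p p
      = ((2 * r ^ (k - 1) * diagCoeff n (k - 1) p * (q.toFun z * v ^ k).re : ℝ) : ℂ) := by
  have ha0 : a s ≠ 0 := by intro h; rw [h] at ha; simp at ha
  obtain ⟨m, rfl⟩ : ∃ m, k = m + 1 := ⟨k - 1, by omega⟩
  rw [Nat.add_sub_cancel]
  have hr' : (r : ℂ) ≠ 0 := by exact_mod_cast hr.ne'
  have hy' : (z.im : ℂ) ≠ 0 := by exact_mod_cast z.im_pos.ne'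
  have h1 : gradDiag n (a s)⁻¹ * hitchinDeformation n r q z v * gradDiag n (a s)
      = (r ^ m * (q.toFun z * v ^ (m + 1)) : ℂ) • (raiseC n).transpose ^ m
        + (r ^ m * (starRingEnd ℂ) (q.toFun z * v ^ (m + 1)) : ℂ) • raiseC n ^ m := by
    rw [hitchinDeformation_eq hr, mul_add, add_mul, mul_smul_comm, smul_mul_assoc, mul_smul_comm,
      smul_mul_assoc, Nat.add_sub_cancel, gradDiag_conj_raiseC_pow ha0,
      gradDiag_conj_transpose_raiseC_pow ha0, smul_smul, smul_smul, inv_sq_eq_of_sq_mul ha,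
      sq_eq_conj_div hr z.im_pos hv ha]
    congr 2
    · ring
    · have : ((((r * z.im : ℝ) : ℂ) ^ 2) ^ m * ((starRingEnd ℂ) v / (r * (z.im : ℂ) ^ 2)) ^ m)
          = (r * (starRingEnd ℂ) v) ^ m := by
        rw [← mul_pow]
        congr 1
        push_cast
        field_simp
      rw [mul_assoc, this, map_mul, map_mul, map_pow]
      ring
  have h2 : ∀ M : Matrix (Fin n) (Fin n) ℂ,
      (transportDiag n (-s) * M * transportDiag n s) p p = M p p := by
    intro M
    have : ((Real.exp (- -s * (weight n p / 2)) : ℝ) : ℂ) *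
        ((Real.exp (-s * (weight n p / 2)) : ℝ) : ℂ)
        = 1 := by
      rw [← ofReal_mul, ← Real.exp_add]; simp
    rw [transportDiag, transportDiag, Matrix.mul_diagonal, Matrix.diagonal_mul]
    linear_combination M p p * this
  have h3 : parallelFrameInv n a s * hitchinDeformation n r q z v * parallelFrame n a s
      = transportDiag n (-s) * (eigenMatrixInvC n
          * (gradDiag n (a s)⁻¹ * hitchinDeformation n r q z v * gradDiag n (a s))
          * eigenMatrixC n) * transportDiag n s := by
    simp only [parallelFrameInv, parallelFrame, mul_assoc]
  rw [h3, h2, h1, mul_add, add_mul, mul_smul_comm, smul_mul_assoc, mul_smul_comm, smul_mul_assoc,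
    Matrix.add_apply, Matrix.smul_apply, Matrix.smul_apply, raiseC_pow_diag,
    transpose_raiseC_pow_diag]
  have h4 := Complex.add_conj (q.toFun z * v ^ (m + 1))
  simp only [smul_eq_mul]
  push_cast at h4 ⊢
  linear_combination (r ^ m * diagCoeff n m p : ℂ) * h4

/-- The sign ambiguity of the square root `a` acts by a scalar: `diag (δ ^ (2 p - n - 1))` is scalar
for `δ = ± 1`. -/
theorem gradDiag_sign {n : ℕ} {δ : ℂ} (hδ : δ ^ 2 = 1) : gradDiag n δ = δ ^ (n + 1) • 1 := by
  have hδ0 : δ ≠ 0 := by rintro rfl; simp at hδ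
  rw [gradDiag, ← Matrix.diagonal_one, ← Matrix.diagonal_smul]
  congr 1
  ext i
  have h1 : weight n i = (n + 1 : ℕ) + 2 * ((i.val : ℤ) - n) := by
    simp only [weight]; push_cast; ring
  rw [h1, zpow_add₀ hδ0, zpow_natCast, zpow_mul, zpow_ofNat, hδ]
  simp

/-- Existence of a parallel frame along a closed geodesic which diagonalizes the holonomy. -/
theorem exists_parallelFrame (n : ℕ) {r : ℝ} (hr : 0 < r) {g : SL(2, ℝ)} {c : ℝ → ℍ} {ℓ : ℝ}
    (hc : IsClosedGeodesic g c ℓ) :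
    ∃ (F Finv : ℝ → Matrix (Fin n) (Fin n) ℂ) (d : Fin n → ℂ),
      (∀ s, HasDerivAt (fun u => (c u : ℂ)) (velocity c s) s) ∧ Continuous (velocity c) ∧
      (∀ i j, Continuous fun s => F s i j) ∧ (∀ i j, Continuous fun s => Finv s i j) ∧
      (∀ s, Finv s * F s = 1) ∧
      (∀ s, HasEntryDerivAt F (-(fuchsianForm n r (c s) (velocity c s) * F s)) s) ∧
      (∀ s, HasEntryDerivAt Finv (Finv s * fuchsianForm n r (c s) (velocity c s)) s) ∧
      F ℓ = automorphy n g (c 0) * F 0 * Matrix.diagonal d ∧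
      (StrictAnti fun i => ‖d i‖) ∧ (∀ i, d i ≠ 0) ∧
      ∀ {Γ : Subgroup SL(2, ℝ)} {k : ℕ} (_ : 1 ≤ k) (q : HolDifferential Γ k) (s : ℝ) (p : Fin n),
        (Finv s * hitchinDeformation n r q (c s) (velocity c s) * F s) p p
          = ((2 * r ^ (k - 1) * diagCoeff n (k - 1) p *
              (q.toFun (c s) * velocity c s ^ k).re : ℝ) : ℂ) := by
  obtain ⟨a, v, hvc, hcv, hvn, hav, ha'⟩ := exists_frame_scale hc.geodesic hr
  have hvel : velocity c = v := funext fun s => (hcv s).deriv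
  have ha0 : ∀ s, a s ≠ 0 := fun s h => by have := hav s; rw [h] at this; simp at this
  have hac : Continuous a := continuous_iff_continuousAt.2 fun s => (ha' s).continuousAt
  have hJ0 : autFactor g (c 0) ≠ 0 := autFactor_ne_zero g (c 0)
  -- `v` is invariant under the deck transformation
  have hvℓ : v ℓ = mobiusDeriv g (c 0) * v 0 := by
    have h1 := hasDerivAt_sl2_smul g (hcv 0)
    have h2 : HasDerivAt (fun u => (c (u + ℓ) : ℂ)) (v ℓ) 0 := by
      have := (hcv (0 + ℓ)).comp_add_const 0 ℓ
      rwa [zero_add] at this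
    have h3 : (fun u => (c (u + ℓ) : ℂ)) = fun u => ((g • c u : ℍ) : ℂ) :=
      funext fun u => by rw [hc.closed]
    rw [h3] at h2
    exact h2.unique h1
  -- `a ℓ` and `J a 0` are square roots of the same number
  set δ : ℂ := a ℓ / (autFactor g (c 0) * a 0) with hδ
  have haℓ : a ℓ = autFactor g (c 0) * a 0 * δ := by
    have := ha0 0
    rw [hδ]; field_simp
  have hδ2 : δ ^ 2 = 1 := by
    have h1 := hav ℓ
    have h2 := hav 0
    rw [hvℓ, mobiusDeriv, haℓ] at h1
    have h3 : (autFactor g (c 0) * a 0 * δ) ^ 2 * (r * ((autFactor g (c 0) ^ 2)⁻¹ * v 0))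
        = δ ^ 2 * (a 0 ^ 2 * (r * v 0)) := by field_simp
    rwa [h3, h2, mul_one] at h1
  have hδn : ‖δ‖ = 1 := by
    have := congrArg norm hδ2
    rw [norm_pow, norm_one] at this
    exact (pow_eq_one_iff_of_nonneg (norm_nonneg δ) two_ne_zero).1 this
  refine ⟨parallelFrame n a, parallelFrameInv n a,
    fun i => δ ^ (n + 1) * ((Real.exp (-ℓ * (weight n i / 2)) : ℝ) : ℂ), ?_⟩
  rw [hvel]
  refine ⟨hcv, hvc, continuous_parallelFrame_apply hac ha0,
    continuous_parallelFrameInv_apply hac ha0,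
    fun s => parallelFrameInv_mul (ha0 s),
    fun s => hasEntryDerivAt_parallelFrame hr (hvn s) (hav s) (ha' s),
    fun s => hasEntryDerivAt_parallelFrameInv hr ha0 (hvn s) (hav s) (ha' s), ?_, ?_, ?_, ?_⟩
  · have h1 : (Matrix.diagonal fun i => δ ^ (n + 1) * ((Real.exp (-ℓ * (weight n i / 2)) : ℝ) : ℂ))
        = δ ^ (n + 1) • transportDiag n ℓ := by
      rw [transportDiag, ← Matrix.diagonal_smul]; rfl
    have h2 : automorphy n g (c 0) = gradDiag n (autFactor g (c 0)) := rfl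
    rw [h1, h2, parallelFrame, parallelFrame, haℓ, ← gradDiag_mul_gradDiag, ← gradDiag_mul_gradDiag,
      gradDiag_sign hδ2, transportDiag_zero]
    simp only [mul_smul_comm, smul_mul_assoc, mul_one, mul_assoc]
  · intro i j hij
    have hw : (weight n i : ℝ) < weight n j := by exact_mod_cast weight_strictMono n hij
    simp only [norm_mul, norm_pow, hδn, one_pow, one_mul, norm_real,
      Real.norm_of_nonneg (Real.exp_pos _).le]
    rw [Real.exp_lt_exp]
    nlinarith [hc.pos]
  · intro i
    refine mul_ne_zero (pow_ne_zero _ ?_) (by exact_mod_cast (Real.exp_pos _).ne')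
    rw [← norm_ne_zero_iff, hδn]; norm_num
  · intro Γ k hk q s p
    exact parallelFrame_hitchinDeformation_diag hr hk q (hvn s) (hav s) p

end HitchinVariation

/-! ### First variation of the holonomy -/

namespace HitchinVariation
open Complex Filter Topology

/-- The chain rule for a function on `ℍ` with exterior derivative `B` along a curve. -/
theorem HasExtDeriv.comp_curve {n : ℕ} {F : ℍ → Matrix (Fin n) (Fin n) ℂ} {B : MatForm n}
    (hF : HasExtDeriv F B) {c : ℝ → ℍ} {v : ℂ} {s : ℝ}
    (hc : HasDerivAt (fun u => (c u : ℂ)) v s) :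
    HasEntryDerivAt (fun u => F (c u)) (B (c s) v) s := by
  intro i j
  have h := (hF (c s) i j).comp_hasDerivAt s hc
  have e : (fun w : ℂ => F (UpperHalfPlane.ofComplex w) i j) ∘ (fun u => (c u : ℂ))
      = fun u => F (c u) i j := by
    ext u; simp only [Function.comp_apply, UpperHalfPlane.ofComplex_apply]
  rw [e] at h
  exact h

/-- `hasDerivAt_log_eigenModulus` for a curve which is diagonal at `t = 0` after conjugation by a
constant matrix. -/
theorem hasDerivAt_log_eigenModulus_of_conj {n : ℕ} {T : ℝ → Matrix (Fin n) (Fin n) ℂ}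
    {T' U Uinv : Matrix (Fin n) (Fin n) ℂ} {d : Fin n → ℂ} (hU : Uinv * U = 1)
    (h0 : Uinv * T 0 * U = Matrix.diagonal d) (hT : HasEntryDerivAt T T' 0)
    (hd : StrictAnti fun i => ‖d i‖) (hd0 : ∀ i, d i ≠ 0) (p : Fin n) :
    HasDerivAt (fun t => Real.log (eigenModulus (T t) (p.val + 1)))
      (((Uinv * T' * U) p p / d p).re) 0 := by
  have hN : HasEntryDerivAt (fun t => Uinv * T t * U) (Uinv * T' * U) 0 := by
    refine (((hasEntryDerivAt_const Uinv 0).mul hT).mul (hasEntryDerivAt_const U 0)).congr_deriv ?_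
    simp
  have h := hasDerivAt_log_eigenModulus (N := fun t => Uinv * T t * U) h0 hN hd hd0 p
  simpa only [eigenModulus_conj _ _ _ hU] using h

/-- `f t s = O(t)` near `t = 0`, uniformly for `s` in `[0, ℓ]`. -/
def IsUniformO (ℓ : ℝ) (f : ℝ → ℝ → ℂ) : Prop :=
  ∃ K : ℝ, 0 ≤ K ∧ ∀ t ∈ Set.Icc (-1 : ℝ) 1, ∀ s ∈ Set.Icc 0 ℓ, ‖f t s‖ ≤ K * |t|

theorem IsUniformO.continuous_mul {ℓ : ℝ} {f : ℝ → ℝ → ℂ} (hf : IsUniformO ℓ f) {h : ℝ → ℂ}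
    (hh : Continuous h) : IsUniformO ℓ fun t s => h s * f t s := by
  obtain ⟨K, hK, hf⟩ := hf
  obtain ⟨M, hM⟩ := isCompact_Icc.exists_bound_of_continuousOn (hh.continuousOn (s := Set.Icc 0 ℓ))
  refine ⟨max M 0 * K, by positivity, fun t ht s hs => ?_⟩
  rw [norm_mul, mul_assoc]
  exact mul_le_mul ((hM s hs).trans (le_max_left _ _)) (hf t ht s hs) (norm_nonneg _)
    (le_max_right _ _)

theorem IsUniformO.mul_continuous {ℓ : ℝ} {f : ℝ → ℝ → ℂ} (hf : IsUniformO ℓ f) {h : ℝ → ℂ}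
    (hh : Continuous h) : IsUniformO ℓ fun t s => f t s * h s := by
  simpa only [mul_comm] using hf.continuous_mul hh

theorem IsUniformO.sum {ι : Type*} (S : Finset ι) {ℓ : ℝ} {f : ι → ℝ → ℝ → ℂ}
    (hf : ∀ i, IsUniformO ℓ (f i)) : IsUniformO ℓ fun t s => ∑ i ∈ S, f i t s := by
  choose K hK hf using hf
  refine ⟨∑ i ∈ S, K i, Finset.sum_nonneg fun i _ => hK i, fun t ht s hs => ?_⟩
  rw [Finset.sum_mul]
  exact (norm_sum_le _ _).trans (Finset.sum_le_sum fun i _ => hf i t ht s hs)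

theorem IsUniformO.add {ℓ : ℝ} {f g : ℝ → ℝ → ℂ} (hf : IsUniformO ℓ f) (hg : IsUniformO ℓ g) :
    IsUniformO ℓ fun t s => f t s + g t s := by
  obtain ⟨K, hK, hf⟩ := hf
  obtain ⟨L, hL, hg⟩ := hg
  refine ⟨K + L, by positivity, fun t ht s hs => ?_⟩
  rw [add_mul]
  exact (norm_add_le _ _).trans (add_le_add (hf t ht s hs) (hg t ht s hs))

theorem exists_uniform_bound {ι : Type*} [Fintype ι] {ℓ : ℝ} {f : ι → ℝ → ℝ → ℂ}
    (hf : ∀ i, IsUniformO ℓ (f i)) :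
    ∃ K : ℝ, 0 ≤ K ∧ ∀ t ∈ Set.Icc (-1 : ℝ) 1, ∀ s ∈ Set.Icc 0 ℓ, ∀ i, ‖f i t s‖ ≤ K * |t| := by
  choose K hK hf using hf
  refine ⟨∑ i, K i, Finset.sum_nonneg fun i _ => hK i, fun t ht s hs i => ?_⟩
  refine (hf i t ht s hs).trans (mul_le_mul_of_nonneg_right ?_ (abs_nonneg t))
  exact Finset.single_le_sum (fun i _ => hK i) (Finset.mem_univ i)

/-- A `C¹` function of `(t, z)` which vanishes at `t = 0` is `O(t)`, uniformly along compact
curves. -/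
theorem isUniformO_of_contDiffOn {Φ : ℝ × ℂ → ℂ} (hΦ : ContDiffOn ℝ 1 Φ {x | 0 < x.2.im})
    {c : ℝ → ℍ} (hc : Continuous fun s => (c s : ℂ)) (h0 : ∀ s, Φ (0, (c s : ℂ)) = 0) (ℓ : ℝ) :
    IsUniformO ℓ fun t s => Φ (t, (c s : ℂ)) := by
  set S : Set (ℝ × ℂ) := Set.Icc (-1 : ℝ) 1 ×ˢ ((fun s => (c s : ℂ)) '' Set.Icc 0 ℓ) with hS
  have hcomp : IsCompact S := isCompact_Icc.prod (isCompact_Icc.image hc)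
  have hopen : IsOpen {x : ℝ × ℂ | 0 < x.2.im} :=
    isOpen_lt continuous_const (Complex.continuous_im.comp continuous_snd)
  have hmem : ∀ x ∈ S, 0 < x.2.im := by
    rintro ⟨t, w⟩ ⟨_, s, _, rfl⟩
    exact (c s).im_pos
  have hloc : LocallyLipschitzOn S Φ := by
    intro x hx
    obtain ⟨K, u, hu, hLip⟩ :=
      (hΦ.contDiffAt (hopen.mem_nhds (hmem x hx))).exists_lipschitzOnWith
    exact ⟨K, u, mem_nhdsWithin_of_mem_nhds hu, hLip⟩
  obtain ⟨K, hK⟩ := hloc.exists_lipschitzOnWith_of_compact hcomp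
  refine ⟨K, K.2, fun t ht s hs => ?_⟩
  have h1 : ((t, (c s : ℂ)) : ℝ × ℂ) ∈ S := ⟨ht, s, hs, rfl⟩
  have h2 : ((0, (c s : ℂ)) : ℝ × ℂ) ∈ S := ⟨by simp, s, hs, rfl⟩
  have := hK.dist_le_mul _ h1 _ h2
  rw [h0, dist_zero_right] at this
  simpa [Prod.dist_eq] using this

theorem matForm_apply_eq {n : ℕ} (B : MatForm n) (z : ℍ) (v : ℂ) (i j : Fin n) :
    B z v i j = (v.re : ℂ) * B z 1 i j + (v.im : ℂ) * B z I i j := by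
  have h : v = v.re • (1 : ℂ) + v.im • I := by
    simp [Complex.re_add_im]
  conv_lhs => rw [h, map_add, map_smul, map_smul]
  simp

theorem automorphy_inv_mul (n : ℕ) (g : SL(2, ℝ)) (z : ℍ) :
    (automorphy n g z)⁻¹ * automorphy n g z = 1 := by
  have h : automorphy n g z = gradDiag n (autFactor g z) := rfl
  rw [h, inv_gradDiag (autFactor_ne_zero g z), gradDiag_inv_mul (autFactor_ne_zero g z)]

theorem continuous_holDifferential {Γ : Subgroup SL(2, ℝ)} {k : ℕ} (q : HolDifferential Γ k) :
    Continuous q.toFun := q.holomorphic.continuous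

/-- First variation of the eigenvalues of the holonomy along a family of connections. -/
theorem hasDerivAt_log_eigenModulus_holonomy {Γ : Subgroup SL(2, ℝ)} {n k : ℕ} (hk : 1 ≤ k) {r : ℝ}
    (hr : 0 < r) (q : HolDifferential Γ k) {γ : Γ} {c : ℝ → ℍ} {ℓ : ℝ}
    (hc : IsClosedGeodesic (γ : SL(2, ℝ)) c ℓ) {B : ℝ → MatForm n}
    (hB : IsConnectionVariation Γ r (hitchinDeformation n r q) B)
    {T : ℝ → Matrix (Fin n) (Fin n) ℂ}
    (hT : ∀ t, IsHolonomy (fun z v => fuchsianForm n r z v + B t z v) γ c ℓ (T t)) (p : Fin n) :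
    HasDerivAt (fun t => Real.log (eigenModulus (T t) (p.val + 1)))
      (-(2 * r ^ (k - 1) * diagCoeff n (k - 1) p * rePeriod q c ℓ)) 0 := by
  obtain ⟨F, Finv, d, hcv, hvc, hFc, hFic, hFF, hF', hFi', hFℓ, hd, hd0, hψ⟩ :=
    exists_parallelFrame n hr hc
  obtain ⟨Z, dZ, hZ, hdZ, hBt⟩ := hB.tangent
  choose V hV0 hV' hTV using hT
  have hcc : Continuous fun s => (c s : ℂ) :=
    continuous_iff_continuousAt.2 fun s => (hcv s).continuousAt
  have hFF' : ∀ s, F s * Finv s = 1 := fun s => mul_eq_one_comm.1 (hFF s)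
  set v := velocity c with hv
  -- in the parallel frame the transport equation is `R' = -C R`, with `C = 0` at `t = 0`
  set C : ℝ → ℝ → Matrix (Fin n) (Fin n) ℂ := fun t s => Finv s * B t (c s) (v s) * F s with hC
  set R : ℝ → ℝ → Matrix (Fin n) (Fin n) ℂ := fun t s => Finv s * V t s * F 0 with hR
  set Ψ : ℝ → Matrix (Fin n) (Fin n) ℂ :=
    fun s => Finv s * hitchinDeformation n r q (c s) (v s) * F s with hΨ
  set DZ : ℝ → Matrix (Fin n) (Fin n) ℂ := fun s => Finv s * (dZ (c s) (v s)
    + fuchsianForm n r (c s) (v s) * Z (c s) - Z (c s) * fuchsianForm n r (c s) (v s)) * F s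
    with hDZ
  have hCe : ∀ t s i j, C t s i j = ∑ l, (∑ m, Finv s i m *
      ((v s).re * B t (c s) 1 m l + (v s).im * B t (c s) I m l)) * F s l j := by
    intro t s i j
    simp only [hC, Matrix.mul_apply, ← matForm_apply_eq]
  -- `C t s = O(t)` uniformly
  have hBO : ∀ e i j, IsUniformO ℓ fun t s => B t (c s) e i j := by
    intro e i j
    have := isUniformO_of_contDiffOn (hB.smooth e i j) hcc (fun s => by simp [hB.zero]) ℓ
    simpa only [UpperHalfPlane.ofComplex_apply] using this
  have hre : Continuous fun s => ((v s).re : ℂ) := by fun_prop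
  have him : Continuous fun s => ((v s).im : ℂ) := by fun_prop
  have hCO : ∀ x : Fin n × Fin n, IsUniformO ℓ fun t s => C t s x.1 x.2 := by
    rintro ⟨i, j⟩
    simp only [hCe]
    exact IsUniformO.sum _ fun l => (IsUniformO.sum _ fun m =>
      (((hBO 1 m l).continuous_mul hre).add ((hBO I m l).continuous_mul him)).continuous_mul
        (hFic i m)).mul_continuous (hFc l j)
  obtain ⟨K, hK, hCK⟩ := exists_uniform_bound hCO
  have hBc : ∀ t e i j, Continuous fun s => B t (c s) e i j := by
    intro t e i j
    have h1 := (hB.smooth e i j).continuousOn.comp_continuous (f := fun s : ℝ => (t, (c s : ℂ)))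
      (by fun_prop) (fun s => (c s).im_pos)
    simpa only [Function.comp_def, UpperHalfPlane.ofComplex_apply] using h1
  have hCc : ∀ t i j, Continuous fun s => C t s i j := by
    intro t i j
    simp only [hCe]
    refine continuous_finsetSum _ fun l _ => (continuous_finsetSum _ fun m _ =>
      (hFic i m).mul ((hre.mul (hBc t 1 m l)).add (him.mul (hBc t I m l)))).mul (hFc l j)
  have hR0 : ∀ t, R t 0 = 1 := fun t => by simp only [hR, hV0, mul_one, hFF]
  have hR' : ∀ t s, HasEntryDerivAt (R t) (-(C t s * R t s)) s := by
    intro t s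
    have hVt : HasEntryDerivAt (V t)
        (-((fuchsianForm n r (c s) (v s) + B t (c s) (v s)) * V t s)) s := hV' t s
    refine (((hFi' s).mul hVt).mul (hasEntryDerivAt_const (F 0) s)).congr_deriv ?_
    have e : C t s * R t s = Finv s * B t (c s) (v s) * (F s * Finv s) * V t s * F 0 := by
      simp only [hC, hR, mul_assoc]
    rw [e, hFF', mul_one]
    simp only [mul_neg, mul_zero, add_zero, add_mul, mul_add, mul_assoc, neg_mul, neg_add]
    abel
  have hCdot : ∀ s, HasEntryDerivAt (fun t => C t s) (Ψ s + DZ s) 0 := by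
    intro s
    have hBs : HasEntryDerivAt (fun t => B t (c s) (v s)) _ 0 := hBt (c s) (v s)
    refine (((hasEntryDerivAt_const (Finv s) 0).mul hBs).mul
      (hasEntryDerivAt_const (F s) 0)).congr_deriv ?_
    simp only [hΨ, hDZ, zero_mul, zero_add, mul_zero, add_zero]
    rw [← add_mul, ← mul_add]
  have htr := fun i j => hasDerivAt_transport hc.pos.le hK hR0 hR' hCc
    (fun t ht s hs i j => hCK t ht s hs (i, j)) hCdot i j
  -- the infinitesimal gauge transformation does not contribute
  have hcℓ : c ℓ = (γ : SL(2, ℝ)) • c 0 := by rw [← hc.closed, zero_add]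
  have hJ := automorphy_inv_mul n (γ : SL(2, ℝ)) (c 0)
  have hgauge : (Finv ℓ * Z (c ℓ) * F ℓ) p p = (Finv 0 * Z (c 0) * F 0) p p := by
    have e : Matrix.diagonal d * (Finv ℓ * Z (c ℓ) * F ℓ)
        = (Finv 0 * Z (c 0) * F 0) * Matrix.diagonal d := by
      have e1 : Matrix.diagonal d = Finv 0 * (automorphy n (γ : SL(2, ℝ)) (c 0))⁻¹ * F ℓ := by
        calc Matrix.diagonal d = Finv 0 * ((automorphy n (γ : SL(2, ℝ)) (c 0))⁻¹ *
              automorphy n (γ : SL(2, ℝ)) (c 0)) * F 0 * Matrix.diagonal d := by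
              rw [hJ, mul_one, hFF, one_mul]
          _ = _ := by rw [hFℓ]; simp only [mul_assoc]
      have e2 : Z (c ℓ) = automorphy n (γ : SL(2, ℝ)) (c 0) * Z (c 0) *
          (automorphy n (γ : SL(2, ℝ)) (c 0))⁻¹ := by rw [hcℓ]; exact hZ γ γ.2 (c 0)
      calc Matrix.diagonal d * (Finv ℓ * Z (c ℓ) * F ℓ)
          = Finv 0 * (automorphy n (γ : SL(2, ℝ)) (c 0))⁻¹ * (F ℓ * Finv ℓ) * Z (c ℓ) * F ℓ := by
            rw [e1]; simp only [mul_assoc]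
        _ = Finv 0 * ((automorphy n (γ : SL(2, ℝ)) (c 0))⁻¹ * automorphy n (γ : SL(2, ℝ)) (c 0)) *
              Z (c 0) * ((automorphy n (γ : SL(2, ℝ)) (c 0))⁻¹ * automorphy n (γ : SL(2, ℝ)) (c 0)) *
              F 0 * Matrix.diagonal d := by
            rw [hFF', e2, hFℓ]; simp only [mul_assoc, mul_one]
        _ = _ := by rw [hJ, mul_one, mul_one]
    have e3 := congrFun (congrFun e p) p
    rw [Matrix.diagonal_mul, Matrix.mul_diagonal, mul_comm] at e3
    exact mul_right_cancel₀ (hd0 p) e3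
  have hZ' : ∀ s, HasEntryDerivAt (fun u => Finv u * Z (c u) * F u) (DZ s) s := by
    intro s
    refine (((hFi' s).mul (hdZ.comp_curve (hcv s))).mul (hF' s)).congr_deriv ?_
    simp only [hDZ, mul_add, add_mul, mul_sub, sub_mul, mul_assoc, mul_neg]
    abel
  have hψc : Continuous fun s => Ψ s p p := by
    simp only [hΨ, hψ hk]
    have : Continuous fun s => q.toFun (c s) :=
      (continuous_holDifferential q).comp hc.geodesic.continuous
    fun_prop
  have hψi : IntervalIntegrable (fun s => Ψ s p p) MeasureTheory.volume 0 ℓ :=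
    hψc.intervalIntegrable 0 ℓ
  have hsum : IntervalIntegrable (fun s => (Ψ s + DZ s) p p) MeasureTheory.volume 0 ℓ :=
    (htr p p).2.1
  -- `d_D Z` need not be continuous a priori; it is integrable as a difference
  have hDZi : IntervalIntegrable (fun s => DZ s p p) MeasureTheory.volume 0 ℓ := by
    refine (hsum.sub hψi).congr ?_
    exact fun s _ => add_sub_cancel_left (Ψ s p p) (DZ s p p)
  have hDZ0 : ∫ s in (0 : ℝ)..ℓ, DZ s p p = 0 := by
    have h1 := intervalIntegral.integral_eq_sub_of_hasDerivAt (fun s _ => hZ' s p p) hDZi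
    exact h1.trans (sub_eq_zero.2 hgauge)
  have hint : ∫ s in (0 : ℝ)..ℓ, (Ψ s + DZ s) p p
      = ((2 * r ^ (k - 1) * diagCoeff n (k - 1) p * rePeriod q c ℓ : ℝ) : ℂ) := by
    have : ∫ s in (0 : ℝ)..ℓ, (Ψ s + DZ s) p p = ∫ s in (0 : ℝ)..ℓ, (Ψ s p p + DZ s p p) := rfl
    rw [this, intervalIntegral.integral_add hψi hDZi, hDZ0, add_zero]
    simp only [hΨ, hψ hk]
    rw [intervalIntegral.integral_ofReal, intervalIntegral.integral_const_mul, rePeriod]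
  -- the holonomy in the parallel frame
  have hTR : ∀ t, Finv 0 * T t * F 0 = Matrix.diagonal d * R t ℓ := by
    intro t
    have e1 : V t ℓ * F 0 = F ℓ * R t ℓ := by
      simp only [hR, ← mul_assoc, hFF', one_mul]
    rw [hTV t, mul_assoc, mul_assoc, e1, hFℓ]
    calc Finv 0 * ((automorphy n (γ : SL(2, ℝ)) (c 0))⁻¹ *
            (automorphy n (γ : SL(2, ℝ)) (c 0) * F 0 * Matrix.diagonal d * R t ℓ))
        = Finv 0 * ((automorphy n (γ : SL(2, ℝ)) (c 0))⁻¹ * automorphy n (γ : SL(2, ℝ)) (c 0)) *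
            F 0 * Matrix.diagonal d * R t ℓ := by simp only [mul_assoc]
      _ = _ := by rw [hJ, mul_one, hFF, one_mul]
  have hTe : ∀ t, T t = F 0 * (Matrix.diagonal d * R t ℓ) * Finv 0 := by
    intro t
    rw [← hTR]
    calc T t = (F 0 * Finv 0) * T t * (F 0 * Finv 0) := by rw [hFF', one_mul, mul_one]
      _ = _ := by simp only [mul_assoc]
  set I' : Matrix (Fin n) (Fin n) ℂ := fun i j => -∫ s in (0 : ℝ)..ℓ, (Ψ s + DZ s) i j with hI'
  have hRℓ : HasEntryDerivAt (fun t => R t ℓ) I' 0 := fun i j => (htr i j).2.2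
  have hT' : HasEntryDerivAt T (F 0 * (Matrix.diagonal d * I') * Finv 0) 0 := by
    have h1 : T = fun t => F 0 * (Matrix.diagonal d * R t ℓ) * Finv 0 := funext hTe
    rw [h1]
    refine (((hasEntryDerivAt_const (F 0) 0).mul ((hasEntryDerivAt_const (Matrix.diagonal d) 0).mul
      hRℓ)).mul (hasEntryDerivAt_const (Finv 0) 0)).congr_deriv ?_
    simp
  have hR0ℓ : R 0 ℓ = 1 := by ext i j; exact (htr i j).1
  have hfin := hasDerivAt_log_eigenModulus_of_conj (hFF 0) (by rw [hTR, hR0ℓ, mul_one]) hT' hd hd0 p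
  refine hfin.congr_deriv ?_
  have e : Finv 0 * (F 0 * (Matrix.diagonal d * I') * Finv 0) * F 0 = Matrix.diagonal d * I' := by
    calc _ = (Finv 0 * F 0) * (Matrix.diagonal d * I') * (Finv 0 * F 0) := by simp only [mul_assoc]
      _ = _ := by rw [hFF, one_mul, mul_one]
  rw [e, Matrix.diagonal_mul, mul_div_cancel_left₀ _ (hd0 p)]
  simp only [hI']
  rw [hint, ← ofReal_neg, ofReal_re]

theorem toComplexMatrix_mul {n : ℕ} (M N : Matrix.SpecialLinearGroup (Fin n) ℝ) :
    toComplexMatrix (M * N) = toComplexMatrix M * toComplexMatrix N := by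
  have h : ∀ M : Matrix.SpecialLinearGroup (Fin n) ℝ,
      toComplexMatrix M = ofRealHom.mapMatrix (M : Matrix (Fin n) (Fin n) ℝ) := fun _ => rfl
  rw [h, h, h, Matrix.SpecialLinearGroup.coe_mul, map_mul]

theorem toComplexMatrix_one (n : ℕ) :
    toComplexMatrix (1 : Matrix.SpecialLinearGroup (Fin n) ℝ) = 1 := by
  have h : toComplexMatrix (1 : Matrix.SpecialLinearGroup (Fin n) ℝ)
    = ofRealHom.mapMatrix (1 : Matrix (Fin n) (Fin n) ℝ) := rfl
  rw [h, map_one]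

/-- First variation of the eigenvalues of the monodromy along a curve of representations. -/
theorem hasDerivAt_log_eigenModulus_monodromy {Γ : Subgroup SL(2, ℝ)} {n k : ℕ} (hk : 1 ≤ k) {r : ℝ}
    (hr : 0 < r) (q : HolDifferential Γ k) {γ : Γ} {c : ℝ → ℍ} {ℓ : ℝ}
    (hc : IsClosedGeodesic (γ : SL(2, ℝ)) c ℓ)
    {δ : ℝ → Γ →* Matrix.SpecialLinearGroup (Fin n) ℝ}
    (hδ : IsRepVariation Γ r (hitchinDeformation n r q) δ) (p : Fin n) :
    HasDerivAt (fun t => Real.log (eigenModulus (toComplexMatrix (δ t γ⁻¹)) (p.val + 1)))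
      (-(2 * r ^ (k - 1) * diagCoeff n (k - 1) p * rePeriod q c ℓ)) 0 := by
  obtain ⟨F, Finv, d, hcv, hvc, hFc, hFic, hFF, hF', hFi', hFℓ, hd, hd0, hψ⟩ :=
    exists_parallelFrame n hr hc
  obtain ⟨G, P, dG, dP, hGdet, hdG, hGpar, hGeq, hdP, hdPe, hδ'⟩ := hδ
  have hFF' : ∀ s, F s * Finv s = 1 := fun s => mul_eq_one_comm.1 (hFF s)
  set v := velocity c with hv
  have hcℓ : c ℓ = (γ : SL(2, ℝ)) • c 0 := by rw [← hc.closed, zero_add]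
  have hJ := automorphy_inv_mul n (γ : SL(2, ℝ)) (c 0)
  -- `G` is the frame `F` up to a constant matrix
  set K := Finv 0 * G (c 0) with hK
  have hGK : ∀ s, Finv s * G (c s) = K := by
    have h1 : ∀ s, HasEntryDerivAt (fun u => Finv u * G (c u)) 0 s := by
      intro s
      refine ((hFi' s).mul (hdG.comp_curve (hcv s))).congr_deriv ?_
      rw [mul_assoc, ← mul_add, add_comm, hGpar, mul_zero]
    intro s
    ext i j
    exact is_const_of_deriv_eq_zero (fun u => (h1 u i j).differentiableAt)
      (fun u => (h1 u i j).deriv) s 0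
  have hG : ∀ s, G (c s) = F s * K := by
    intro s; rw [← hGK s, ← mul_assoc, hFF', one_mul]
  set Kinv := (G (c 0))⁻¹ * F 0 with hKinv
  have hKK' : Kinv * K = 1 := by
    rw [hKinv, hK, mul_assoc, ← mul_assoc (F 0), hFF', one_mul, Matrix.nonsing_inv_mul _ (hGdet _)]
  have hKK : K * Kinv = 1 := mul_eq_one_comm.1 hKK'
  have hGinv : ∀ s, (G (c s))⁻¹ = Kinv * Finv s := by
    intro s
    refine Matrix.inv_eq_left_inv ?_
    rw [mul_assoc, hGK, hKK']
  clear_value K Kinv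
  -- the monodromy in the parallel frame
  set D0 := toComplexMatrix (δ 0 γ⁻¹) with hD0
  have hD : K * D0 = Matrix.diagonal d * K := by
    have e1 := hGeq γ (c 0)
    rw [← hcℓ, hG, hG, hFℓ] at e1
    have e2 : toComplexMatrix (δ 0 γ) * D0 = 1 := by
      rw [hD0, ← toComplexMatrix_mul, ← map_mul, mul_inv_cancel, map_one, toComplexMatrix_one]
    have e3 : Matrix.diagonal d * K * toComplexMatrix (δ 0 γ) = K := by
      calc Matrix.diagonal d * K * toComplexMatrix (δ 0 γ)
          = (Finv 0 * F 0) * Matrix.diagonal d * K * toComplexMatrix (δ 0 γ) := by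
            rw [hFF, one_mul]
        _ = Finv 0 * ((automorphy n (γ : SL(2, ℝ)) (c 0))⁻¹ * automorphy n (γ : SL(2, ℝ)) (c 0)) *
              F 0 * Matrix.diagonal d * K * toComplexMatrix (δ 0 γ) := by rw [hJ, mul_one]
        _ = Finv 0 * ((automorphy n (γ : SL(2, ℝ)) (c 0))⁻¹ *
              (automorphy n (γ : SL(2, ℝ)) (c 0) * F 0 * Matrix.diagonal d * K
                * toComplexMatrix (δ 0 γ))) := by simp only [mul_assoc]
        _ = Finv 0 * ((automorphy n (γ : SL(2, ℝ)) (c 0))⁻¹ *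
              automorphy n (γ : SL(2, ℝ)) (c 0)) * F 0 * K := by rw [e1]; simp only [mul_assoc]
        _ = K := by rw [hJ, mul_one, hFF, one_mul]
    calc K * D0 = Matrix.diagonal d * K * (toComplexMatrix (δ 0 γ) * D0) := by
          rw [← mul_assoc, e3]
      _ = _ := by rw [e2, mul_one]
  -- the cocycle formula is applied to `γ⁻¹` at the point `γ c(0)`
  have hT' : HasEntryDerivAt (fun t => toComplexMatrix (δ t γ⁻¹))
      (P (c 0) * D0 - D0 * P (c ℓ)) 0 := by
    have h2 : ((γ⁻¹ : Γ) : SL(2, ℝ)) • c ℓ = c 0 := by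
      rw [hcℓ]
      exact inv_smul_smul (γ : SL(2, ℝ)) (c 0)
    have h1 : HasEntryDerivAt (fun t => toComplexMatrix (δ t γ⁻¹))
      (P (((γ⁻¹ : Γ) : SL(2, ℝ)) • c ℓ) * D0 - D0 * P (c ℓ)) 0 := hδ' γ⁻¹ (c ℓ)
    rw [h2] at h1
    exact h1
  have hDd : K * D0 * Kinv = Matrix.diagonal d := by rw [hD, mul_assoc, hKK, mul_one]
  have hfin := hasDerivAt_log_eigenModulus_of_conj
    (T := fun t => toComplexMatrix (δ t γ⁻¹)) hKK hDd hT' hd hd0 p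
  refine hfin.congr_deriv ?_
  have hP' : ∀ s, HasEntryDerivAt (fun u => K * P (c u) * Kinv)
      (Finv s * hitchinDeformation n r q (c s) (v s) * F s) s := by
    intro s
    refine (((hasEntryDerivAt_const K s).mul (hdP.comp_curve (hcv s))).mul
      (hasEntryDerivAt_const Kinv s)).congr_deriv ?_
    have e1 : K * (G (c s))⁻¹ = Finv s := by rw [hGinv, ← mul_assoc, hKK, one_mul]
    have e2 : G (c s) * Kinv = F s := by rw [hG, mul_assoc, hKK, mul_one]
    rw [zero_mul, zero_add, mul_zero, add_zero, hdPe, ← e1, ← e2]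
    simp only [mul_assoc]
  have hψc : Continuous fun s => (Finv s * hitchinDeformation n r q (c s) (v s) * F s) p p := by
    simp only [hψ hk]
    have : Continuous fun s => q.toFun (c s) :=
      (continuous_holDifferential q).comp hc.geodesic.continuous
    fun_prop
  have hint := intervalIntegral.integral_eq_sub_of_hasDerivAt (fun s _ => hP' s p p)
    (hψc.intervalIntegrable 0 ℓ)
  simp only [hψ hk] at hint
  rw [intervalIntegral.integral_ofReal, intervalIntegral.integral_const_mul] at hint
  have e : K * (P (c 0) * D0 - D0 * P (c ℓ)) * Kinv
      = (K * P (c 0) * Kinv) * Matrix.diagonal d - Matrix.diagonal d * (K * P (c ℓ) * Kinv) := by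
    have e1 : D0 * Kinv = Kinv * Matrix.diagonal d := by
      calc D0 * Kinv = (Kinv * K) * D0 * Kinv := by rw [hKK', one_mul]
        _ = Kinv * (K * D0 * Kinv) := by simp only [mul_assoc]
        _ = _ := by rw [hDd]
    have e2 : K * (P (c 0) * D0) * Kinv = (K * P (c 0) * Kinv) * Matrix.diagonal d := by
      rw [mul_assoc, mul_assoc, e1]; simp only [mul_assoc]
    have e3 : K * (D0 * P (c ℓ)) * Kinv = Matrix.diagonal d * (K * P (c ℓ) * Kinv) := by
      rw [← mul_assoc, hD]; simp only [mul_assoc]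
    rw [mul_sub, sub_mul, e2, e3]
  rw [e, Matrix.sub_apply, Matrix.mul_diagonal, Matrix.diagonal_mul, mul_comm, ← mul_sub,
    mul_div_cancel_left₀ _ (hd0 p), ← neg_sub, ← hint, ← ofReal_neg, ofReal_re, rePeriod]

theorem hasFirstVariation_gardinerCoeff {Γ : Subgroup SL(2, ℝ)} {n k : ℕ} (hk : 2 ≤ k)
    (hkn : k ≤ n) {r : ℝ} (hr : 0 < r) (q : HolDifferential Γ k) {γ : Γ} {c : ℝ → ℍ} {ℓ : ℝ}
    (hc : IsClosedGeodesic (γ : SL(2, ℝ)) c ℓ) {p : ℕ} (hp : 1 ≤ p) (hpn : p ≤ n) :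
    HasFirstVariation Γ r (hitchinDeformation n r q) γ c ℓ p
      (r ^ (k - 1) * gardinerCoeff n k p * rePeriod q c ℓ) := by
  obtain ⟨a, rfl⟩ : ∃ a, p = a + 1 := ⟨p - 1, by omega⟩
  have e : r ^ (k - 1) * gardinerCoeff n k (a + 1) * rePeriod q c ℓ
      = -(2 * r ^ (k - 1) * diagCoeff n (k - 1) a * rePeriod q c ℓ) := by
    rw [gardinerCoeff_eq_diagCoeff hk hkn hp hpn, Nat.add_sub_cancel]; ring
  rw [e]
  exact ⟨fun B hB T hT => hasDerivAt_log_eigenModulus_holonomy (by omega) hr q hc hB hT ⟨a, hpn⟩,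
    fun δ hδ => hasDerivAt_log_eigenModulus_monodromy (by omega) hr q hc hδ ⟨a, hpn⟩⟩

end HitchinVariation

theorem theorem4p1 (Γ : Subgroup SL(2, ℝ)) (hΓ : HitchinVariation.IsSurfaceGroup Γ)
    (n k : ℕ) (hk : 2 ≤ k) (hkn : k ≤ n) (r : ℝ) (hr : 0 < r)
    (q : HitchinVariation.HolDifferential Γ k)
    (γ : Γ) (c : ℝ → ℍ) (ℓ : ℝ) (hγ : HitchinVariation.IsClosedGeodesic (γ : SL(2, ℝ)) c ℓ) :
    HitchinVariation.HasFirstVariation Γ r (HitchinVariation.hitchinDeformation n r q) γ c ℓ 1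
      (r ^ (k - 1) * ((-1) ^ k * ((n - 1).factorial : ℝ) / (2 ^ (k - 2) * (n - k).factorial)) *
        HitchinVariation.rePeriod q c ℓ) ∧
    (∀ p : ℕ, 1 ≤ p → p ≤ n →
      HitchinVariation.HasFirstVariation Γ r (HitchinVariation.hitchinDeformation n r q) γ c ℓ p
        (r ^ (k - 1) * HitchinVariation.gardinerCoeff n k p * HitchinVariation.rePeriod q c ℓ)) ∧
    (k = n → ∀ p : ℕ, 1 ≤ p → p ≤ n →
      HitchinVariation.HasFirstVariation Γ r (HitchinVariation.hitchinDeformation n r q) γ c ℓ p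
        (r ^ (n - 1) * ((-1) ^ (p + n + 1) * (((n - 1).factorial : ℝ) / 2 ^ (n - 2)) *
          ((n - 1).choose (p - 1) : ℝ)) * HitchinVariation.rePeriod q c ℓ)) := by
  refine ⟨?_, fun p hp hpn =>
    HitchinVariation.hasFirstVariation_gardinerCoeff hk hkn hr q hγ hp hpn, ?_⟩
  · rw [← HitchinVariation.gardinerCoeff_one hk hkn]
    exact HitchinVariation.hasFirstVariation_gardinerCoeff hk hkn hr q hγ le_rfl (by omega)
  · rintro rfl p hp hpn
    rw [← HitchinVariation.gardinerCoeff_self hk hp hpn]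
    exact HitchinVariation.hasFirstVariation_gardinerCoeff hk hkn hr q hγ hp hpn
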